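/- Let $n\ge 3$ be odd and let $\Omega\subset\mathbb{R}^n$ be a bounded, strictly convex domain with smooth boundary (strictly convex: $\overline\Omega$ is strictly convex, i.e. $\partial\Omega$ contains no segments). For $f\in C^{n-1}(\overline\Omega)$ vanishing outside $\Omega$ and $0\le i\le\frac{n-1}{2}$, the values of $(-\Delta)^i f$ on $\partial\Omega$ are the continuous extensions from $\Omega$. Put $(-\Delta)^{\frac n2}:=(-\Delta)^{\frac12}\circ(-\Delta)^{\frac{n-1}{2}}$, where, for $w\in L^1_{loc}(\mathbb{R}^n)$ with $\int_{\mathbb{R}^n}\frac{|w(x)|}{1+|x|^{n+1}}\,dx<\infty$, $$(-\Delta)^{\frac12}w(x)=C_n\lim_{\delta\to0^+}\int_{\mathbb{R}^n\setminus B_\delta(x)}\frac{w(x)-w(y)}{|x-y|^{n+1}}\,dy,\qquad C_n=\frac{\Gamma(\frac{n+1}{2})}{\pi^{\frac{n+1}{2}}}.$$ Then for every $x^0\in\partial\Omega$, with unit inward normal $\nu^0$ of $\partial\Omega$ at $x^0$, there is $\delta_0>0$, depending only on $x^0$ and $\Omega$, with the following property. Let $p\ge1$, $q\ge1$, $pq>1$,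 and let $u,v:\mathbb{R}^n\to\mathbb{R}$, positive in $\Omega$ and belonging to $C^{n,\varepsilon}_{loc}(\Omega)\cap C^{n-1}(\overline\Omega)$ for some $\varepsilon\in(0,1)$, satisfy $$\begin{cases}(-\Delta)^{\frac n2}u(x)=v^p(x),\quad (-\Delta)^{\frac n2}v(x)=u^q(x), & x\in\Omega,\\ u(x)=-\Delta u(x)=\cdots=(-\Delta)^{\frac{n-1}{2}}u(x)=0, & x\in\mathbb{R}^n\setminus\Omega,\\ v(x)=-\Delta v(x)=\cdots=(-\Delta)^{\frac{n-1}{2}}v(x)=0, & x\in\mathbb{R}^n\setminus\Omega.\end{cases}$$ Then, for each $i=0,1,\dots,\frac{n-1}{2}$, the functions $(-\Delta)^i u$ and $(-\Delta)^i v$ are strictly increasing in the direction $\nu^0$ in $$\tilde\Sigma_{\delta_0}=\{x\in\overline\Omega \mid 0\le (x-x^0)\cdot\nu^0\le\delta_0\},$$ that is, $(-\Delta)^i u(x)<(-\Delta)^i u(x+t\nu^0)$ and $(-\Delta)^i v(x)<(-\Delta)^i v(x+t\nu^0)$ whenever $t>0$ and $x,\,x+t\nu^0\in\tilde\Sigma_{\delta_0}$.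 -/

import Mathlib

open scoped ContDiff Topology NNReal

noncomputable section

namespace LaneEmden

/-- `n`-dimensional Euclidean space. -/
abbrev E (n : ℕ) : Type := EuclideanSpace ℝ (Fin n)

/-! ### Domains -/

/-- `ρ` is a smooth defining function of `Ω` on the open neighbourhood `U` of the boundary point
`x₀`: inside `U`, `Ω` is `{ρ > 0}` and `∂Ω` is `{ρ = 0}`, and `∇ρ(x₀) ≠ 0`. -/
structure IsLocalDefiningFunction {n : ℕ} (Ω : Set (E n)) (x₀ : E n) (U : Set (E n))
    (ρ : E n → ℝ) : Prop where
  isOpen : IsOpen U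
  mem : x₀ ∈ U
  smooth : ContDiffOn ℝ ∞ ρ U
  gradient_ne_zero : gradient ρ x₀ ≠ 0
  mem_domain_iff : ∀ x ∈ U, x ∈ Ω ↔ 0 < ρ x
  mem_frontier_iff : ∀ x ∈ U, x ∈ frontier Ω ↔ ρ x = 0

/-- `Ω` has a smooth boundary. -/
def HasSmoothBoundary {n : ℕ} (Ω : Set (E n)) : Prop :=
  ∀ x₀ ∈ frontier Ω, ∃ (U : Set (E n)) (ρ : E n → ℝ), IsLocalDefiningFunction Ω x₀ U ρ

/-- `ν` is the unit inward normal of `∂Ω` at `x₀`: the normalized gradient of a smooth function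
that is positive inside `Ω` and vanishes on `∂Ω` near `x₀`. -/
def IsUnitInwardNormal {n : ℕ} (Ω : Set (E n)) (x₀ ν : E n) : Prop :=
  ∃ (U : Set (E n)) (ρ : E n → ℝ), IsLocalDefiningFunction Ω x₀ U ρ ∧
    ν = ‖gradient ρ x₀‖⁻¹ • gradient ρ x₀

/-- A bounded and strictly convex domain with smooth boundary. Strict convexity (no segments in
the boundary) is a condition on the closure: every open convex set is `StrictConvex`. -/
structure IsSmoothStrictlyConvexDomain {n : ℕ} (Ω : Set (E n)) : Prop where
  isOpen : IsOpen Ω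
  nonempty : Ω.Nonempty
  bounded : Bornology.IsBounded Ω
  convex : Convex ℝ Ω
  strictConvex_closure : StrictConvex ℝ (closure Ω)
  smooth_boundary : HasSmoothBoundary Ω

/-! ### Powers of the Laplacian -/

open scoped Classical in
/-- `-Δ f`, with one-sided derivatives from `Ω` at the points of `∂Ω`. At the points of `Ω` and at
the points outside `closure Ω` this is the usual `-Δ f`; on `∂Ω`, for `f` of class `C²` on
`closure Ω`, it is the continuous extension of `-Δ f` from `Ω`. -/
def negLaplacian {n : ℕ} (Ω : Set (E n)) (f : E n → ℝ) (x : E n) : ℝ :=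
  if x ∈ closure Ω then -InnerProductSpace.laplacianWithin f (closure Ω) x
  else -Laplacian.laplacian f x

/-- `(-Δ)^i f`, for `i` a natural number. -/
def negLaplacianPow {n : ℕ} (Ω : Set (E n)) (i : ℕ) (f : E n → ℝ) : E n → ℝ :=
  (negLaplacian Ω)^[i] f

/-- The space `𝓛_{2σ}`: locally integrable `f` with `∫ |f(x)| / (1 + |x|^{n+2σ}) dx < ∞`. -/
def MemFracSpace {n : ℕ} (σ : ℝ) (f : E n → ℝ) : Prop :=
  MeasureTheory.LocallyIntegrable f MeasureTheory.volume ∧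
    MeasureTheory.Integrable (fun x : E n => |f x| / (1 + ‖x‖ ^ ((n : ℝ) + 2 * σ)))
      MeasureTheory.volume

/-- The normalization constant `C_{n,σ} = 4^σ σ Γ(n/2+σ) / (π^{n/2} Γ(1-σ))`, for `0 < σ < 1`. -/
def fracConst (n : ℕ) (σ : ℝ) : ℝ :=
  4 ^ σ * σ * Real.Gamma ((n : ℝ) / 2 + σ) / (Real.pi ^ ((n : ℝ) / 2) * Real.Gamma (1 - σ))

/-- `f` belongs to `𝓛_{2σ}`, the principal value defining `(-Δ)^σ f(x)` exists, and
`(-Δ)^σ f(x) = L`. -/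
def HasFracLaplacianAt {n : ℕ} (σ : ℝ) (f : E n → ℝ) (x : E n) (L : ℝ) : Prop :=
  MemFracSpace σ f ∧
    Filter.Tendsto
      (fun δ : ℝ => fracConst n σ *
        ∫ y in (Metric.ball x δ)ᶜ, (f x - f y) / ‖x - y‖ ^ ((n : ℝ) + 2 * σ))
      (𝓝[>] 0) (𝓝 L)

/-- For odd `n`: `(-Δ)^{n/2} f(x) = L`, where `(-Δ)^{n/2} = (-Δ)^{1/2} ∘ (-Δ)^{(n-1)/2}`. -/
def HasHalfDimLaplacianAt {n : ℕ} (Ω : Set (E n)) (f : E n → ℝ) (x : E n) (L : ℝ) : Prop :=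
  HasFracLaplacianAt (1 / 2) (negLaplacianPow Ω ((n - 1) / 2) f) x L

/-! ### Solutions -/

/-- `f ∈ C^{k,ε}_loc(Ω)` for an open set `Ω`. -/
def MemHolderLoc {n : ℕ} (k : ℕ) (ε : ℝ≥0) (Ω : Set (E n)) (f : E n → ℝ) : Prop :=
  ContDiffOn ℝ k f Ω ∧
    ∀ K : Set (E n), K ⊆ Ω → IsCompact K →
      ∃ C : ℝ≥0, HolderOnWith C ε (iteratedFDeriv ℝ k f) K

/-- `f ∈ C^{n,ε}_loc(Ω) ∩ C^{n-1}(closure Ω)` for some `0 < ε < 1`. -/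
def IsClassical {n : ℕ} (Ω : Set (E n)) (f : E n → ℝ) : Prop :=
  (∃ ε : ℝ≥0, 0 < ε ∧ ε < 1 ∧ MemHolderLoc n ε Ω f) ∧
    ContDiffOn ℝ ((n - 1 : ℕ) : WithTop ℕ∞) f (closure Ω)

/-- `(u, v)` is a pair of positive classical solutions (`n` odd) of
`(-Δ)^{n/2} u = v^p`, `(-Δ)^{n/2} v = u^q` in `Ω`, with
`(-Δ)^i u = (-Δ)^i v = 0` in `ℝⁿ \ Ω` for `i = 0, …, (n-1)/2`. -/
structure IsPositiveClassicalSolution {n : ℕ} (Ω : Set (E n)) (p q : ℝ) (u v : E n → ℝ) :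
    Prop where
  classical_u : IsClassical Ω u
  classical_v : IsClassical Ω v
  pos_u : ∀ x ∈ Ω, 0 < u x
  pos_v : ∀ x ∈ Ω, 0 < v x
  eq_u : ∀ x ∈ Ω, HasHalfDimLaplacianAt Ω u x (v x ^ p)
  eq_v : ∀ x ∈ Ω, HasHalfDimLaplacianAt Ω v x (u x ^ q)
  navier_u : ∀ i ≤ (n - 1) / 2, ∀ x ∉ Ω, negLaplacianPow Ω i u x = 0
  navier_v : ∀ i ≤ (n - 1) / 2, ∀ x ∉ Ω, negLaplacianPow Ω i v x = 0

/-! ### Monotonicity in a boundary layer -/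

/-- The boundary layer `{x ∈ closure Ω | 0 ≤ (x - x₀) · ν ≤ δ}`. -/
def boundaryLayer {n : ℕ} (Ω : Set (E n)) (x₀ ν : E n) (δ : ℝ) : Set (E n) :=
  {x | x ∈ closure Ω ∧ 0 ≤ inner ℝ (x - x₀) ν ∧ inner ℝ (x - x₀) ν ≤ δ}

/-- `f` is strictly increasing along the direction `ν` in `S`. -/
def StrictlyIncreasingAlong {n : ℕ} (f : E n → ℝ) (ν : E n) (S : Set (E n)) : Prop :=
  ∀ x ∈ S, ∀ t : ℝ, 0 < t → x + t • ν ∈ S → f x < f (x + t • ν)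

end LaneEmden

end

/-!
With `U i = (-Δ)^i u`, the problem `(-Δ)^(m + σ) u = g` is a chain `-Δ (U i) = U (i + 1)`, closed by
`(-Δ)^σ (U m) = g`. Let `x^κ` be the reflection of `x` in the hyperplane `{⟪·, ν⟫ = κ}` and
`w i x = U i x^κ - U i x`, for `x` in the cap of `Ω` below this hyperplane. As `w m` is
antisymmetric, folding the principal value along the hyperplane gives an upper bound for
`(-Δ)^σ (w m)` at a negative minimum, so that `w m ≥ -C a` in the cap as soon as the reflected
difference of `g` is `≥ -a`. The barrier argument for `-Δ` in a slab carries this bound down the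
chain to `w 0`. Where every point of `{w 0 < 0}` is within `ε` of the complement of the cap, a
parabolic barrier improves it to `w 0 ≥ -C a ε²`, and for the coupled system, with locally
Lipschitz nonlinearities and `ε` small, this forces `w 0 ≥ 0` for both components. If the
differences are nonnegative for one `κ`, they are positive in the cap, hence for `κ' > κ` near `κ`
they can be negative only near the complement of the cap, and the hyperplane can be moved on as long
as the reflected caps stay in `Ω`. Strict monotonicity between `x` and `x + t • ν` is positivity of
the reflected difference for the hyperplane halfway between the two points.
-/

noncomputable section

namespace LaneEmden

/-! ### Minimum principles for the Laplacian -/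

section Calculus

variable {F : Type*} [NormedAddCommGroup F] [InnerProductSpace ℝ F]

theorem deriv_deriv_nonneg_of_isLocalMin {f : ℝ → ℝ} {a : ℝ} (hc : ContinuousAt f a)
    (hmin : IsLocalMin f a) : 0 ≤ deriv (deriv f) a := by
  by_contra! hneg
  have hmax := isLocalMax_of_deriv_deriv_neg hneg hmin.deriv_eq_zero hc
  have hconst : f =ᶠ[𝓝 a] fun _ => f a := by
    filter_upwards [hmin, hmax] with x hge hle using le_antisymm hle hge
  have hzero : deriv (deriv f) a = 0 := by
    rw [hconst.deriv.deriv_eq]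
    simp
  exact hneg.ne hzero

theorem fderiv_fderiv_nonneg_of_isLocalMin {f : F → ℝ} {x : F} (hf : ContDiffAt ℝ 2 f x)
    (hmin : IsLocalMin f x) (w : F) : 0 ≤ fderiv ℝ (fderiv ℝ f) x w w := by
  let l : ℝ → F := fun t => x + t • w
  have hl0 : l 0 = x := by simp [l]
  have hl : ∀ t, HasDerivAt l w t := fun t => by
    simpa [l] using ((hasDerivAt_id t).smul_const w).const_add x
  have hlc : Filter.Tendsto l (𝓝 0) (𝓝 x) := by simpa only [hl0] using (hl 0).continuousAt.tendsto
  have hfirst : deriv (f ∘ l) =ᶠ[𝓝 0] fun t => fderiv ℝ f (l t) w := by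
    have hdiff : ∀ᶠ y in 𝓝 x, DifferentiableAt ℝ f y :=
      (hf.eventually (by simp)).mono fun y hy => hy.differentiableAt (by simp)
    filter_upwards [hlc.eventually hdiff] with t ht
    exact (ht.hasFDerivAt.comp_hasDerivAt t (hl t)).deriv
  have hsecond : deriv (deriv (f ∘ l)) 0 = fderiv ℝ (fderiv ℝ f) x w w := by
    have hfd : DifferentiableAt ℝ (fderiv ℝ f) (l 0) := by
      rw [hl0]
      exact (hf.fderiv_right (m := 1) (by norm_num)).differentiableAt (by simp)
    rw [hfirst.deriv_eq, ← hl0]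
    exact ((hfd.hasFDerivAt.comp_hasDerivAt 0 (hl 0)).clm_apply
      (hasDerivAt_const 0 w)).deriv.trans (by simp)
  rw [← hsecond]
  refine deriv_deriv_nonneg_of_isLocalMin (hf.continuousAt.comp_of_eq (hl 0).continuousAt hl0) ?_
  simpa [IsLocalMin, IsMinFilter, hl0] using hlc.eventually hmin

variable [FiniteDimensional ℝ F]

theorem laplacian_nonneg_of_isLocalMin {f : F → ℝ} {x : F} (hf : ContDiffAt ℝ 2 f x)
    (hmin : IsLocalMin f x) : 0 ≤ Laplacian.laplacian f x := by
  rw [InnerProductSpace.laplacian_eq_iteratedFDeriv_stdOrthonormalBasis]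
  refine Finset.sum_nonneg fun i _ => ?_
  rw [iteratedFDeriv_two_apply]
  exact fderiv_fderiv_nonneg_of_isLocalMin hf hmin _

theorem laplacian_comp_linearIsometryEquiv_add (f : F → ℝ) (L : F ≃ₗᵢ[ℝ] F) (c x : F) :
    Laplacian.laplacian (fun y => f (L y + c)) x = Laplacian.laplacian f (L x + c) := by
  let b := stdOrthonormalBasis ℝ F
  have hcomp : (fun y => f (L y + c)) = (fun z => f (z + c)) ∘ L.toContinuousLinearEquiv := rfl
  rw [InnerProductSpace.laplacian_eq_iteratedFDeriv_orthonormalBasis _ b,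
    InnerProductSpace.laplacian_eq_iteratedFDeriv_orthonormalBasis _ (b.map L)]
  refine Finset.sum_congr rfl fun i _ => ?_
  rw [hcomp, ← iteratedFDerivWithin_univ, ← Set.preimage_univ (f := L.toContinuousLinearEquiv),
    ContinuousLinearEquiv.iteratedFDerivWithin_comp_right _ _ uniqueDiffOn_univ (Set.mem_univ _),
    iteratedFDerivWithin_univ, iteratedFDeriv_comp_add_right]
  simp only [ContinuousMultilinearMap.compContinuousLinearMap_apply, OrthonormalBasis.map_apply]
  congr 1
  ext j
  fin_cases j <;> rfl

theorem laplacian_quadratic {e : F} (he : ‖e‖ = 1) (z : F) (a b : ℝ) (x : F) :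
    Laplacian.laplacian (fun y : F => a * inner ℝ e (y - z) + b * inner ℝ e (y - z) ^ 2) x
      = 2 * b := by
  have hinner : ∀ y : F, HasFDerivAt (fun y : F => inner ℝ e (y - z)) (innerSL ℝ e) y := fun y =>
    (innerSL ℝ e).hasFDerivAt.comp y ((hasFDerivAt_id y).sub_const z)
  have hfirst : fderiv ℝ (fun y : F => a * inner ℝ e (y - z) + b * inner ℝ e (y - z) ^ 2)
      = fun y => (a + 2 * b * inner ℝ e (y - z)) • innerSL ℝ e := by
    ext1 y
    refine (((hinner y).const_mul a).add (((hinner y).pow 2).const_mul b)).fderiv.trans ?_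
    ext w
    simp
    ring
  have hsecond : fderiv ℝ (fun y : F => (a + 2 * b * inner ℝ e (y - z)) • innerSL ℝ e) x
      = ((2 * b) • innerSL ℝ e).smulRight (innerSL ℝ e) :=
    ((((hinner x).const_mul (2 * b)).const_add a).smul_const (innerSL ℝ e)).fderiv
  have hparseval := (stdOrthonormalBasis ℝ F).sum_inner_mul_inner e e
  rw [real_inner_self_eq_norm_sq, he] at hparseval
  rw [InnerProductSpace.laplacian_eq_iteratedFDeriv_stdOrthonormalBasis]
  simp only [iteratedFDeriv_two_apply, hfirst, hsecond, Matrix.cons_val_zero, Matrix.cons_val_one,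
    ContinuousLinearMap.smulRight_apply, smul_apply, innerSL_apply_apply, smul_eq_mul]
  calc _ = 2 * b * ∑ i, inner ℝ e (stdOrthonormalBasis ℝ F i) *
        inner ℝ (stdOrthonormalBasis ℝ F i) e := by
        rw [Finset.mul_sum]
        refine Finset.sum_congr rfl fun i _ => ?_
        rw [real_inner_comm e]
        ring
    _ = 2 * b := by rw [hparseval]; ring

end Calculus

section MinimumPrinciple

variable {F : Type*} [NormedAddCommGroup F] [InnerProductSpace ℝ F] [FiniteDimensional ℝ F]
  {D : Set F} {U : F → ℝ}

theorem nonneg_of_laplacian_neg (hDo : IsOpen D) (hDb : Bornology.IsBounded D)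
    (hUc : ContinuousOn U (closure D)) (hU2 : ∀ x ∈ D, ContDiffAt ℝ 2 U x)
    (hUf : ∀ x ∈ frontier D, 0 ≤ U x) (hΔ : ∀ x ∈ D, Laplacian.laplacian U x < 0) :
    ∀ x ∈ closure D, 0 ≤ U x := by
  intro x hx
  obtain ⟨y, hy, hmin⟩ := hDb.isCompact_closure.exists_isMinOn ⟨x, hx⟩ hUc
  suffices y ∈ frontier D from (hUf y this).trans (hmin hx)
  rw [hDo.frontier_eq]
  refine ⟨hy, fun hyD => (hΔ y hyD).not_ge (laplacian_nonneg_of_isLocalMin (hU2 y hyD) ?_)⟩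
  filter_upwards [hDo.mem_nhds hyD] with w hw using hmin (subset_closure hw)

theorem exists_unit_inner_pos (hDo : IsOpen D) (hDc : Convex ℝ D) (hDn : D.Nonempty) {z : F}
    (hz : z ∉ D) : ∃ e : F, ‖e‖ = 1 ∧ ∀ y ∈ D, 0 < inner ℝ e (y - z) := by
  obtain ⟨f, hf⟩ := geometric_hahn_banach_point_open hDc hDo hz
  let g := (InnerProductSpace.toDual ℝ F).symm f
  have hg : ∀ y ∈ D, 0 < inner ℝ g (y - z) := fun y hy => by
    rw [InnerProductSpace.toDual_symm_apply, map_sub, sub_pos]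
    exact hf y hy
  obtain ⟨y₀, hy₀⟩ := hDn
  have hg0 : g ≠ 0 := fun h0 => by simpa [h0] using hg y₀ hy₀
  refine ⟨‖g‖⁻¹ • g, norm_smul_inv_norm hg0, fun y hy => ?_⟩
  rw [real_inner_smul_left]
  exact mul_pos (inv_pos.mpr (norm_pos_iff.mpr hg0)) (hg y hy)

/-- The concave parabola in `t` with second derivative `-A` that vanishes at `t = 0` and equals `b`
at `t = 2ε`; evaluated at the distance to a hyperplane it is the barrier of the minimum principle in
a slab. -/
def slabBarrier (A b ε t : ℝ) : ℝ := (b / (2 * ε) + A * ε) * t + -(A / 2) * t ^ 2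

theorem slabBarrier_two_mul (A b : ℝ) {ε : ℝ} (hε : 0 < ε) : slabBarrier A b ε (2 * ε) = b := by
  rw [slabBarrier]
  field_simp
  ring

theorem slabBarrier_nonneg {A b ε t : ℝ} (hA : 0 ≤ A) (hb : 0 ≤ b) (hε : 0 < ε) (ht : 0 ≤ t)
    (ht' : t ≤ 2 * ε) : 0 ≤ slabBarrier A b ε t := by
  have hfactor : slabBarrier A b ε t = b / (2 * ε) * t + A / 2 * t * (2 * ε - t) := by
    rw [slabBarrier]
    ring
  have := sub_nonneg.mpr ht'
  rw [hfactor]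
  positivity

theorem slabBarrier_le {A b ε t : ℝ} (hA : 0 ≤ A) (hb : 0 ≤ b) (hε : 0 < ε) (ht : t ≤ ε) :
    slabBarrier A b ε t ≤ (b + A * ε ^ 2) / 2 := by
  have hlin : b / (2 * ε) * t ≤ b / 2 := by
    calc b / (2 * ε) * t ≤ b / (2 * ε) * ε := by gcongr
      _ = b / 2 := by field_simp
  have hsq := mul_nonneg hA (sq_nonneg (ε - t))
  rw [slabBarrier]
  linarith

theorem neg_half_le_of_mem_slab (hDo : IsOpen D) (hDb : Bornology.IsBounded D)
    (hUc : ContinuousOn U (closure D)) (hU2 : ∀ x ∈ D, ContDiffAt ℝ 2 U x)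
    (hUf : ∀ x ∈ frontier D, 0 ≤ U x) {e z : F} (he : ‖e‖ = 1)
    (hpos : ∀ y ∈ D, 0 < inner ℝ e (y - z)) {A b ε : ℝ} (hA : 0 ≤ A) (hb : 0 ≤ b) (hε : 0 < ε)
    (hΔ : ∀ x ∈ D, Laplacian.laplacian U x < A) (hUb : ∀ x ∈ closure D, -b ≤ U x) :
    ∀ x ∈ D, inner ℝ e (x - z) < ε → -((b + A * ε ^ 2) / 2) ≤ U x := by
  let S : Set F := {y | inner ℝ e (y - z) < 2 * ε}
  let P : F → ℝ := fun y => slabBarrier A b ε (inner ℝ e (y - z))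
  have hinner : ContDiff ℝ 2 fun y : F => (inner ℝ e (y - z) : ℝ) :=
    contDiff_const.inner ℝ (contDiff_id.sub contDiff_const)
  have hSo : IsOpen S := isOpen_lt hinner.continuous continuous_const
  have hP : ContDiff ℝ 2 P :=
    (contDiff_const.mul hinner).add (contDiff_const.mul (hinner.pow 2))
  have hfrontier : ∀ y ∈ frontier (D ∩ S), 0 ≤ U y + P y := by
    intro y hy
    have hyc := frontier_subset_closure hy
    have hyD : y ∈ closure D := closure_mono Set.inter_subset_left hyc
    rcases frontier_inter_subset D S hy with ⟨hyf, hyS⟩ | ⟨-, hyf⟩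
    · exact add_nonneg (hUf y hyf) (slabBarrier_nonneg hA hb hε
        (closure_lt_subset_le continuous_const hinner.continuous (closure_mono hpos hyD))
        (closure_lt_subset_le hinner.continuous continuous_const hyS))
    · have hyeq : inner ℝ e (y - z) = 2 * ε :=
        frontier_lt_subset_eq hinner.continuous continuous_const hyf
      have hPy : P y = b := by simp only [P, hyeq, slabBarrier_two_mul A b hε]
      linarith [hUb y hyD]
  have hUP : ∀ x ∈ closure (D ∩ S), 0 ≤ (U + P) x := by
    refine nonneg_of_laplacian_neg (hDo.inter hSo) (hDb.subset Set.inter_subset_left)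
      ((hUc.mono (closure_mono Set.inter_subset_left)).add hP.continuous.continuousOn)
      (fun x hx => (hU2 x hx.1).add hP.contDiffAt) hfrontier fun x hx => ?_
    have hΔP : Laplacian.laplacian P x = 2 * -(A / 2) := laplacian_quadratic he z _ _ x
    rw [(hU2 x hx.1).laplacian_add hP.contDiffAt, hΔP]
    linarith [hΔ x hx.1]
  intro x hx hxε
  have hUPx : 0 ≤ U x + P x := hUP x (subset_closure ⟨hx, hxε.trans (by linarith)⟩)
  linarith [slabBarrier_le hA hb hε hxε.le]

/-- In a convex domain every point of the complement lies behind a supporting hyperplane, so a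
minimum point `ε`-close to the complement lies in a slab of width `ε`. -/
theorem neg_mul_sq_le_of_narrow (hDo : IsOpen D) (hDc : Convex ℝ D)
    (hDb : Bornology.IsBounded D) {A ε : ℝ} (hA : 0 ≤ A) (hε : 0 < ε)
    (hUc : ContinuousOn U (closure D)) (hU2 : ∀ x ∈ D, ContDiffAt ℝ 2 U x)
    (hUf : ∀ x ∈ frontier D, 0 ≤ U x) (hΔ : ∀ x ∈ D, Laplacian.laplacian U x ≤ A)
    (hnarrow : ∀ x ∈ D, U x < 0 → ∃ z ∉ D, ‖x - z‖ < ε) :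
    ∀ x ∈ D, -(A * ε ^ 2) ≤ U x := by
  intro x hx
  obtain ⟨y, hy, hmin⟩ := hDb.isCompact_closure.exists_isMinOn ⟨x, subset_closure hx⟩ hUc
  refine le_trans ?_ (hmin (subset_closure hx))
  by_contra! hlt
  have hyneg : U y < 0 := hlt.trans_le (by simp only [Left.neg_nonpos_iff]; positivity)
  have hyD : y ∈ D := by
    by_contra hyD
    exact hyneg.not_ge (hUf y (hDo.frontier_eq ▸ ⟨hy, hyD⟩))
  obtain ⟨z, hzD, hz⟩ := hnarrow y hyD hyneg
  obtain ⟨e, he, hpos⟩ := exists_unit_inner_pos hDo hDc ⟨y, hyD⟩ hzD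
  have hyε : inner ℝ e (y - z) < ε :=
    ((real_inner_le_norm e (y - z)).trans (by rw [he, one_mul])).trans_lt hz
  have hbound : ∀ A' > A, -U y ≤ A' * ε ^ 2 := fun A' hA' => by
    have := neg_half_le_of_mem_slab hDo hDb hUc hU2 hUf he hpos (hA.trans hA'.le)
      (neg_nonneg.mpr hyneg.le) hε (fun w hw => (hΔ w hw).trans_lt hA')
      (fun w hw => (neg_neg (U y)).trans_le (hmin hw)) y hyD hyε
    linarith
  have hA_lt : A < -U y / ε ^ 2 := by
    rw [lt_div_iff₀ (by positivity)]
    linarith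
  obtain ⟨A', hA', hA'lt⟩ := exists_between hA_lt
  rw [lt_div_iff₀ (by positivity)] at hA'lt
  exact (hbound A' hA').not_gt hA'lt

end MinimumPrinciple

/-! ### Reflection in a hyperplane -/

section Reflection

variable {F : Type*} [NormedAddCommGroup F] [InnerProductSpace ℝ F]

/-- The reflection in the hyperplane `{x | ⟪x, ν⟫ = κ}`, for a unit vector `ν`. As an isometry
defined for every `ν`, it is the linear reflection in `νᗮ` followed by the translation by
`2κ • ν`. -/
def planeReflection (ν : F) (κ : ℝ) : F ≃ᵢ F :=
  (ℝ ∙ ν)ᗮ.reflection.toIsometryEquiv.trans (IsometryEquiv.addRight ((2 * κ) • ν))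

theorem planeReflection_apply (ν : F) (κ : ℝ) (x : F) :
    planeReflection ν κ x = (ℝ ∙ ν)ᗮ.reflection x + (2 * κ) • ν := rfl

theorem planeReflection_involutive (ν : F) (κ : ℝ) :
    Function.Involutive (planeReflection ν κ) := fun x => by
  rw [planeReflection_apply, planeReflection_apply, map_add, map_smul,
    Submodule.reflection_reflection, Submodule.reflection_orthogonalComplement_singleton_eq_neg]
  module

theorem contDiff_planeReflection (ν : F) (κ : ℝ) {k : WithTop ℕ∞} :
    ContDiff ℝ k (planeReflection ν κ) :=
  (ℝ ∙ ν)ᗮ.reflection.contDiff.add contDiff_const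

theorem laplacian_comp_planeReflection [FiniteDimensional ℝ F] (ν : F) (κ : ℝ) (f : F → ℝ)
    (x : F) : Laplacian.laplacian (f ∘ planeReflection ν κ) x
      = Laplacian.laplacian f (planeReflection ν κ x) :=
  laplacian_comp_linearIsometryEquiv_add f (ℝ ∙ ν)ᗮ.reflection ((2 * κ) • ν) x

variable {ν : F} {κ : ℝ}

theorem planeReflection_eq_add_smul (hν : ‖ν‖ = 1) (κ : ℝ) (x : F) :
    planeReflection ν κ x = x + (2 * (κ - inner ℝ x ν)) • ν := by
  rw [planeReflection_apply, Submodule.reflection_orthogonal_apply,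
    Submodule.reflection_singleton_apply, hν, real_inner_comm]
  module

theorem inner_planeReflection (hν : ‖ν‖ = 1) (κ : ℝ) (x : F) :
    inner ℝ (planeReflection ν κ x) ν = 2 * κ - inner ℝ x ν := by
  rw [planeReflection_eq_add_smul hν, inner_add_left, real_inner_smul_left,
    real_inner_self_eq_norm_sq, hν]
  ring

theorem norm_sub_planeReflection_sq (hν : ‖ν‖ = 1) (κ : ℝ) (x y : F) :
    ‖x - planeReflection ν κ y‖ ^ 2
      = ‖x - y‖ ^ 2 + 4 * ((κ - inner ℝ x ν) * (κ - inner ℝ y ν)) := by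
  have hsub : x - planeReflection ν κ y = (x - y) - (2 * (κ - inner ℝ y ν)) • ν := by
    rw [planeReflection_eq_add_smul hν]
    abel
  rw [hsub, norm_sub_sq_real, real_inner_smul_right, inner_sub_left, norm_smul, hν, mul_one,
    Real.norm_eq_abs, sq_abs]
  ring

theorem norm_sub_le_norm_sub_planeReflection (hν : ‖ν‖ = 1) {x y : F}
    (hx : inner ℝ x ν ≤ κ) (hy : inner ℝ y ν ≤ κ) : ‖x - y‖ ≤ ‖x - planeReflection ν κ y‖ := by
  refine le_of_sq_le_sq ?_ (norm_nonneg _)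
  rw [norm_sub_planeReflection_sq hν]
  linarith [mul_nonneg (sub_nonneg.mpr hx) (sub_nonneg.mpr hy)]

theorem norm_sub_lt_norm_sub_planeReflection (hν : ‖ν‖ = 1) {x y : F}
    (hx : inner ℝ x ν < κ) (hy : inner ℝ y ν < κ) : ‖x - y‖ < ‖x - planeReflection ν κ y‖ := by
  refine lt_of_pow_lt_pow_left₀ 2 (norm_nonneg _) ?_
  rw [norm_sub_planeReflection_sq hν]
  linarith [mul_pos (sub_pos.mpr hx) (sub_pos.mpr hy)]

end Reflection

section Folding

open MeasureTheory

theorem setIntegral_eq_half_of_preimage_eq {X : Type*} [MeasurableSpace X] {μ : Measure X}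
    {R : X → X} (hR : MeasurableEmbedding R) (hRμ : MeasurePreserving R μ μ) {J : X → ℝ}
    {C : Set X} (hRC : R ⁻¹' C = C) (hJ : IntegrableOn J C μ) :
    IntegrableOn (fun y => J y + J (R y)) C μ ∧
      ∫ y in C, J y ∂μ = (∫ y in C, (J y + J (R y)) ∂μ) / 2 := by
  have hJR : IntegrableOn (fun y => J (R y)) C μ := by
    rw [← hRμ.integrableOn_comp_preimage hR, hRC] at hJ
    exact hJ
  have hinv : ∫ y in C, J (R y) ∂μ = ∫ y in C, J y ∂μ := by
    rw [← hRμ.setIntegral_preimage_emb hR J C, hRC]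
  refine ⟨hJ.add hJR, ?_⟩
  rw [integral_add hJ hJR, hinv]
  ring

theorem setIntegral_le_mul_measureReal {X : Type*} [MeasurableSpace X] {μ : Measure X}
    {f : X → ℝ} {A C : Set X} (hf : IntegrableOn f C μ) (hf0 : ∀ y, f y ≤ 0) (hAC : A ⊆ C)
    (hA : MeasurableSet A) (hAfin : μ A ≠ ⊤) {t : ℝ} (ht : ∀ y ∈ A, f y ≤ t) :
    ∫ y in C, f y ∂μ ≤ t * μ.real A := by
  have hneg : ∫ y in A, -f y ∂μ ≤ ∫ y in C, -f y ∂μ :=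
    setIntegral_mono_set hf.neg (ae_of_all _ fun y => neg_nonneg.mpr (hf0 y)) hAC.eventuallyLE
  have hconst : ∫ y in A, f y ∂μ ≤ ∫ _ in A, t ∂μ :=
    setIntegral_mono_on (hf.mono_set hAC) (integrableOn_const hAfin) hA ht
  rw [setIntegral_const, smul_eq_mul] at hconst
  rw [integral_neg, integral_neg] at hneg
  linarith

variable {X : Type*} [MetricSpace X] [ProperSpace X] [MeasurableSpace X] [BorelSpace X]
  {μ : Measure X} [IsFiniteMeasureOnCompacts μ] {J : X → ℝ}

theorem tendsto_setIntegral_ball_zero {z : X} (hz : μ {z} = 0) {r : ℝ} (hr : 0 < r)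
    (hJ : IntegrableOn J (Metric.ball z r) μ) :
    Filter.Tendsto (fun δ : ℝ => ∫ y in Metric.ball z δ, J y ∂μ) (𝓝[>] 0) (𝓝 0) := by
  have hball : Filter.Tendsto (fun δ : ℝ => μ (Metric.ball z δ)) (𝓝[>] 0) (𝓝 0) := by
    have := tendsto_measure_thickening_of_isClosed (μ := μ) (s := {z})
      ⟨1, one_pos, by simpa only [Metric.thickening_singleton] using measure_ball_lt_top.ne⟩
      isClosed_singleton
    simpa only [Metric.thickening_singleton, hz] using this
  have hrestrict : Filter.Tendsto (fun δ : ℝ => μ.restrict (Metric.ball z r) (Metric.ball z δ))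
      (𝓝[>] 0) (𝓝 0) :=
    tendsto_of_tendsto_of_tendsto_of_le_of_le tendsto_const_nhds hball (fun _ => zero_le)
      fun _ => Measure.restrict_le_self _
  refine (Integrable.tendsto_setIntegral_nhds_zero hJ hrestrict).congr' ?_
  filter_upwards [nhdsWithin_le_nhds (Iio_mem_nhds hr)] with δ (hδ : δ < r)
  rw [Measure.restrict_restrict Metric.isOpen_ball.measurableSet,
    Set.inter_eq_left.mpr (Metric.ball_subset_ball hδ.le)]

/-- Away from two balls interchanged by the involution `R` the integral of `J` is half of that of
the folded integrand `J + J ∘ R`, and the integral over the second ball is negligible. -/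
theorem le_of_tendsto_setIntegral_of_folded_le (R : X ≃ᵢ X) (hRμ : MeasurePreserving R μ μ)
    (hRR : Function.Involutive R) {x : X} (hRx : R x ≠ x) (hμx : μ {R x} = 0)
    (hJ : ∀ δ > 0, IntegrableOn J (Metric.ball x δ)ᶜ μ) (hfold : ∀ y, J y + J (R y) ≤ 0)
    {A : Set X} (hA : MeasurableSet A) (hAfin : μ A ≠ ⊤) {r : ℝ} (hr : 0 < r)
    (hAx : Disjoint A (Metric.ball x r)) (hARx : Disjoint A (Metric.ball (R x) r)) {t L : ℝ}
    (ht : ∀ y ∈ A, J y + J (R y) ≤ t)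
    (hL : Filter.Tendsto (fun δ : ℝ => ∫ y in (Metric.ball x δ)ᶜ, J y ∂μ) (𝓝[>] 0) (𝓝 L)) :
    L ≤ t * μ.real A / 2 := by
  have hd : 0 < dist x (R x) / 2 := half_pos (dist_pos.mpr hRx.symm)
  have hballs : ∀ δ ≤ dist x (R x) / 2, Metric.ball (R x) δ ⊆ (Metric.ball x δ)ᶜ := fun δ hδ =>
    (Metric.ball_disjoint_ball (by linarith)).subset_compl_left
  have hrem := tendsto_setIntegral_ball_zero hμx hd ((hJ _ hd).mono_set (hballs _ le_rfl))
  refine le_of_tendsto_of_tendsto hL (by simpa only [add_zero] using hrem.const_add _) ?_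
  filter_upwards [self_mem_nhdsWithin, nhdsWithin_le_nhds (Iio_mem_nhds hd),
    nhdsWithin_le_nhds (Iio_mem_nhds hr)] with δ (hδ : 0 < δ) (hδd : δ < _) (hδr : δ < r)
  let C := (Metric.ball x δ)ᶜ \ Metric.ball (R x) δ
  have hJC : IntegrableOn J C μ := (hJ δ hδ).mono_set Set.sdiff_subset
  have hRC : R ⁻¹' C = C := by
    have hdist : ∀ y, dist (R y) x = dist y (R x) := fun y => by
      rw [← R.dist_eq y (R x), hRR]
    ext y
    simp only [C, Set.mem_preimage, Set.mem_sdiff, Set.mem_compl_iff, Metric.mem_ball, hdist,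
      R.dist_eq, and_comm]
  obtain ⟨hJRC, hhalf⟩ :=
    setIntegral_eq_half_of_preimage_eq R.toHomeomorph.measurableEmbedding hRμ hRC hJC
  have hAC : A ⊆ C := Set.subset_sdiff.mpr
    ⟨(hAx.mono_right (Metric.ball_subset_ball hδr.le)).subset_compl_right,
      hARx.mono_right (Metric.ball_subset_ball hδr.le)⟩
  calc ∫ y in (Metric.ball x δ)ᶜ, J y ∂μ
      = (∫ y in C, J y ∂μ) + ∫ y in Metric.ball (R x) δ, J y ∂μ := by
        rw [setIntegral_sdiff Metric.isOpen_ball.measurableSet (hJ δ hδ) (hballs δ hδd.le),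
          sub_add_cancel]
    _ = (∫ y in C, (J y + J (R y)) ∂μ) / 2 + ∫ y in Metric.ball (R x) δ, J y ∂μ :=
        congrArg (· + _) hhalf
    _ ≤ t * μ.real A / 2 + ∫ y in Metric.ball (R x) δ, J y ∂μ := by
        gcongr
        exact setIntegral_le_mul_measureReal hJRC hfold hAC hA hAfin ht

end Folding

/-! ### The fractional Laplacian -/

section FractionalLaplacian

open MeasureTheory

variable {n : ℕ} {σ : ℝ} {f g : E n → ℝ} {x : E n}

/-- The integrand of the principal value integral defining `(-Δ)^σ f(x)`. -/
def fracIntegrand (σ : ℝ) (f : E n → ℝ) (x y : E n) : ℝ :=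
  (f x - f y) / ‖x - y‖ ^ ((n : ℝ) + 2 * σ)

theorem fracConst_pos (n : ℕ) (hσ₀ : 0 < σ) (hσ₁ : σ < 1) : 0 < fracConst n σ := by
  have : 0 < Real.Gamma ((n : ℝ) / 2 + σ) := Real.Gamma_pos_of_pos (by positivity)
  have : 0 < Real.Gamma (1 - σ) := Real.Gamma_pos_of_pos (sub_pos.mpr hσ₁)
  have := Real.pi_pos
  unfold fracConst
  positivity

theorem one_add_rpow_le_two_rpow_mul {t s : ℝ} (ht : 0 ≤ t) (hs : 0 ≤ s) :
    (1 + t) ^ s ≤ 2 ^ s * (1 + t ^ s) := by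
  have hmax : 1 + t ≤ 2 * max 1 t := by linarith [le_max_left 1 t, le_max_right 1 t]
  have hmax_rpow : max 1 t ^ s ≤ 1 + t ^ s := by
    rcases max_choice 1 t with h | h <;> rw [h]
    · rw [Real.one_rpow]
      linarith [Real.rpow_nonneg ht s]
    · linarith
  calc (1 + t) ^ s ≤ (2 * max 1 t) ^ s := by gcongr
    _ = 2 ^ s * max 1 t ^ s := Real.mul_rpow zero_le_two (by positivity)
    _ ≤ 2 ^ s * (1 + t ^ s) := by gcongr

theorem memFracSpace_of_continuous_of_bounded (hσ : 0 < σ) (hf : Continuous f) {M : ℝ}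
    (hM : ∀ y, |f y| ≤ M) : MemFracSpace σ f := by
  refine ⟨hf.locallyIntegrable, ?_⟩
  have hs : (Module.finrank ℝ (E n) : ℝ) < (n : ℝ) + 2 * σ := by
    rw [finrank_euclideanSpace_fin]
    linarith
  refine ((integrable_one_add_norm hs).const_mul (M * 2 ^ ((n : ℝ) + 2 * σ))).mono'
    (by have := hf.measurable; fun_prop : Measurable _).aestronglyMeasurable
    (ae_of_all _ fun y => ?_)
  have hM₀ : 0 ≤ M := (abs_nonneg _).trans (hM y)
  rw [Real.norm_of_nonneg (by positivity), Real.rpow_neg (by positivity), ← div_eq_mul_inv,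
    div_le_div_iff₀ (by positivity) (by positivity), mul_assoc]
  exact mul_le_mul (hM y) (one_add_rpow_le_two_rpow_mul (norm_nonneg y) (by positivity))
    (by positivity) hM₀

theorem integrableOn_inv_norm_sub_rpow_compl_ball {F : Type*} [NormedAddCommGroup F]
    [NormedSpace ℝ F] [FiniteDimensional ℝ F] [MeasurableSpace F] [BorelSpace F] {μ : Measure F}
    [μ.IsAddHaarMeasure] (x : F) {δ s : ℝ} (hδ : 0 < δ) (hs : (Module.finrank ℝ F : ℝ) < s) :
    IntegrableOn (fun y : F => (‖x - y‖ ^ s)⁻¹) (Metric.ball x δ)ᶜ μ := by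
  have hs₀ : 0 < s := lt_of_le_of_lt (Nat.cast_nonneg _) hs
  have hint : Integrable (fun y : F => (1 + ‖x - y‖) ^ (-s)) μ :=
    (integrable_one_add_norm hs).comp_sub_left x
  refine (hint.const_mul ((1 + 1 / δ) ^ s)).integrableOn.mono'
    (by fun_prop : Measurable _).aestronglyMeasurable ?_
  filter_upwards [ae_restrict_mem Metric.isOpen_ball.measurableSet.compl] with y hy
  have hδy : δ ≤ ‖x - y‖ := by
    rw [← dist_eq_norm, dist_comm]
    exact not_lt.mp hy
  have hpos : 0 < ‖x - y‖ := hδ.trans_le hδy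
  have hδy' : 1 + ‖x - y‖ ≤ (1 + 1 / δ) * ‖x - y‖ := by
    have : 1 ≤ 1 / δ * ‖x - y‖ := by rwa [one_div_mul_eq_div, one_le_div hδ]
    linarith
  rw [Real.norm_of_nonneg (by positivity), Real.rpow_neg (by positivity), ← div_eq_mul_inv,
    inv_eq_one_div, div_le_div_iff₀ (by positivity) (by positivity), one_mul,
    ← Real.mul_rpow (by positivity) hpos.le]
  exact Real.rpow_le_rpow (by positivity) hδy' hs₀.le

theorem integrableOn_fracIntegrand_compl_ball (hσ : 0 < σ) (hf : Continuous f) {M : ℝ}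
    (hM : ∀ y, |f y| ≤ M) (x : E n) {δ : ℝ} (hδ : 0 < δ) :
    IntegrableOn (fracIntegrand σ f x) (Metric.ball x δ)ᶜ := by
  have hs : (Module.finrank ℝ (E n) : ℝ) < (n : ℝ) + 2 * σ := by
    rw [finrank_euclideanSpace_fin]
    linarith
  refine ((integrableOn_inv_norm_sub_rpow_compl_ball x hδ hs).const_mul (2 * M)).mono'
    (by have := hf.measurable; unfold fracIntegrand; fun_prop :
      Measurable _).aestronglyMeasurable (ae_of_all _ fun y => ?_)
  have hfxy : |f x - f y| ≤ 2 * M := (abs_sub _ _).trans (by linarith [hM x, hM y])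
  rw [fracIntegrand, div_eq_mul_inv, norm_mul, Real.norm_of_nonneg (r := (_ ^ _)⁻¹) (by positivity)]
  exact mul_le_mul_of_nonneg_right hfxy (by positivity)

theorem measurePreserving_isometryEquiv (R : E n ≃ᵢ E n) : MeasurePreserving R := by
  have := R.measurePreserving_euclideanHausdorffMeasure n
  rwa [EuclideanSpace.euclideanHausdorffMeasure_eq_volume] at this

theorem HasFracLaplacianAt.comp_isometryEquiv (hσ : 0 < σ) (hf : Continuous f) {M : ℝ}
    (hM : ∀ y, |f y| ≤ M) (R : E n ≃ᵢ E n) {L : ℝ} (h : HasFracLaplacianAt σ f (R x) L) :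
    HasFracLaplacianAt σ (f ∘ R) x L := by
  refine ⟨memFracSpace_of_continuous_of_bounded hσ (hf.comp R.continuous) fun y => hM (R y),
    h.2.congr fun δ => ?_⟩
  rw [← (measurePreserving_isometryEquiv R).setIntegral_preimage_emb
    R.toHomeomorph.measurableEmbedding, Set.preimage_compl, R.preimage_ball, R.symm_apply_apply]
  simp only [Function.comp_apply, ← dist_eq_norm, R.dist_eq]

theorem HasFracLaplacianAt.sub (hσ : 0 < σ) (hf : Continuous f) (hg : Continuous g) {M N : ℝ}
    (hM : ∀ y, |f y| ≤ M) (hN : ∀ y, |g y| ≤ N) {L L' : ℝ} (h : HasFracLaplacianAt σ f x L)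
    (h' : HasFracLaplacianAt σ g x L') :
    HasFracLaplacianAt σ (fun y => f y - g y) x (L - L') := by
  refine ⟨memFracSpace_of_continuous_of_bounded (M := M + N) hσ (hf.sub hg) fun y =>
    (abs_sub _ _).trans (add_le_add (hM y) (hN y)), (h.2.sub h'.2).congr' ?_⟩
  filter_upwards [self_mem_nhdsWithin] with δ (hδ : 0 < δ)
  have hsub := integral_sub (integrableOn_fracIntegrand_compl_ball hσ hf hM x hδ)
    (integrableOn_fracIntegrand_compl_ball hσ hg hN x hδ)
  simp only [fracIntegrand, ← sub_div] at hsub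
  simp only [← mul_sub, ← hsub, sub_sub_sub_comm]

theorem HasFracLaplacianAt.nonpos_of_forall_le (hσ₀ : 0 < σ) (hσ₁ : σ < 1) {L : ℝ}
    (h : HasFracLaplacianAt σ f x L) (hmin : ∀ y, f x ≤ f y) : L ≤ 0 :=
  le_of_tendsto' h.2 fun _ => mul_nonpos_of_nonneg_of_nonpos (fracConst_pos n hσ₀ hσ₁).le <|
    integral_nonpos fun y =>
      div_nonpos_of_nonpos_of_nonneg (sub_nonpos.mpr (hmin y)) (by positivity)

end FractionalLaplacian

section AntisymmetricMinimum

open MeasureTheory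

variable {n : ℕ} {σ : ℝ} {ν x : E n} {κ : ℝ} {w : E n → ℝ}

theorem div_le_div_of_nonpos_left {a b c : ℝ} (ha : a ≤ 0) (hb : 0 < b) (hbc : b ≤ c) :
    a / b ≤ a / c := by
  simpa only [neg_div, neg_le_neg_iff] using div_le_div_of_nonneg_left (neg_nonneg.mpr ha) hb hbc

/-- `w` is odd with respect to the hyperplane `{⟪·, ν⟫ = κ}`, and its minimum over the half-space
`{⟪·, ν⟫ ≤ κ}` is nonpositive and attained at the interior point `x`. At such a point the
fractional Laplacian of `w` obeys a maximum principle, although `w` may be smaller elsewhere. -/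
structure IsAntisymmetricMinAt (ν : E n) (κ : ℝ) (w : E n → ℝ) (x : E n) : Prop where
  norm_eq_one : ‖ν‖ = 1
  odd : ∀ y, w (planeReflection ν κ y) = -w y
  inner_lt : inner ℝ x ν < κ
  nonpos : w x ≤ 0
  le : ∀ y, inner ℝ y ν ≤ κ → w x ≤ w y

namespace IsAntisymmetricMinAt

theorem folded_le (h : IsAntisymmetricMinAt ν κ w x) (hσ : 0 ≤ σ) {y : E n}
    (hy : inner ℝ y ν ≤ κ) :
    fracIntegrand σ w x y + fracIntegrand σ w x (planeReflection ν κ y)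
      ≤ 2 * w x / ‖x - planeReflection ν κ y‖ ^ ((n : ℝ) + 2 * σ) := by
  have hcloser : (w x - w y) / ‖x - y‖ ^ ((n : ℝ) + 2 * σ)
      ≤ (w x - w y) / ‖x - planeReflection ν κ y‖ ^ ((n : ℝ) + 2 * σ) := by
    rcases eq_or_ne x y with rfl | hne
    · simp only [sub_self, zero_div, le_refl]
    have hpos : 0 < ‖x - y‖ := norm_sub_pos_iff.mpr hne
    refine div_le_div_of_nonpos_left (sub_nonpos.mpr (h.le y hy)) (by positivity) ?_
    gcongr
    exact norm_sub_le_norm_sub_planeReflection h.norm_eq_one h.inner_lt.le hy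
  calc _ ≤ (w x - w y) / ‖x - planeReflection ν κ y‖ ^ ((n : ℝ) + 2 * σ)
        + (w x + w y) / ‖x - planeReflection ν κ y‖ ^ ((n : ℝ) + 2 * σ) := by
        rw [fracIntegrand, fracIntegrand, h.odd, sub_neg_eq_add]
        gcongr
    _ = _ := by rw [← add_div]; ring

theorem folded_nonpos (h : IsAntisymmetricMinAt ν κ w x) (hσ : 0 ≤ σ) (y : E n) :
    fracIntegrand σ w x y + fracIntegrand σ w x (planeReflection ν κ y) ≤ 0 := by
  have hlower : ∀ z, inner ℝ z ν ≤ κ →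
      fracIntegrand σ w x z + fracIntegrand σ w x (planeReflection ν κ z) ≤ 0 := fun z hz =>
    (h.folded_le hσ hz).trans
      (div_nonpos_of_nonpos_of_nonneg (by linarith [h.nonpos]) (by positivity))
  rcases le_total (inner ℝ y ν) κ with hy | hy
  · exact hlower y hy
  · have := hlower (planeReflection ν κ y) (by rw [inner_planeReflection h.norm_eq_one]; linarith)
    rwa [planeReflection_involutive, add_comm] at this

theorem fracLaplacian_le (h : IsAntisymmetricMinAt ν κ w x) (hσ₀ : 0 < σ) (hσ₁ : σ < 1)
    (hw : Continuous w) {M : ℝ} (hM : ∀ y, |w y| ≤ M) {L : ℝ} (hL : HasFracLaplacianAt σ w x L)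
    {A : Set (E n)} (hA : MeasurableSet A) (hAfin : volume A ≠ ⊤)
    (hAκ : ∀ y ∈ A, inner ℝ y ν < κ) {r : ℝ} (hr : 0 < r) (hAr : Disjoint A (Metric.ball x r))
    {t : ℝ} (ht : ∀ y ∈ A,
      fracIntegrand σ w x y + fracIntegrand σ w x (planeReflection ν κ y) ≤ t) :
    L ≤ fracConst n σ * (t * volume.real A / 2) := by
  have hd : 0 < κ - inner ℝ x ν := sub_pos.mpr h.inner_lt
  have hinnerR := inner_planeReflection h.norm_eq_one κ x
  have hRx : planeReflection ν κ x ≠ x := fun heq => by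
    rw [heq] at hinnerR
    linarith
  have hARx : Disjoint A (Metric.ball (planeReflection ν κ x) (κ - inner ℝ x ν)) := by
    refine Set.disjoint_left.mpr fun y hy hyR => ?_
    have hle := real_inner_le_norm (planeReflection ν κ x - y) ν
    rw [h.norm_eq_one, mul_one, inner_sub_left, hinnerR, ← dist_eq_norm, dist_comm] at hle
    linarith [hAκ y hy, Metric.mem_ball.mp hyR]
  have : Nontrivial (E n) := ⟨_, _, hRx⟩
  have hC := fracConst_pos n hσ₀ hσ₁
  have hlim := hL.2.const_mul (fracConst n σ)⁻¹
  simp only [inv_mul_cancel_left₀ hC.ne'] at hlim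
  rw [← inv_mul_le_iff₀ hC]
  exact le_of_tendsto_setIntegral_of_folded_le (planeReflection ν κ)
    (measurePreserving_isometryEquiv _) (planeReflection_involutive ν κ) hRx (measure_singleton _)
    (fun δ hδ => integrableOn_fracIntegrand_compl_ball hσ₀ hw hM x hδ) (h.folded_nonpos hσ₀.le)
    hA hAfin (lt_min hr hd) (hAr.mono_right (Metric.ball_subset_ball (min_le_left _ _)))
    (hARx.mono_right (Metric.ball_subset_ball (min_le_right _ _))) ht hlim

theorem fracLaplacian_le_of_norm_le (h : IsAntisymmetricMinAt ν κ w x) (hσ₀ : 0 < σ)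
    (hσ₁ : σ < 1) (hw : Continuous w) {M : ℝ} (hM : ∀ y, |w y| ≤ M) {L : ℝ}
    (hL : HasFracLaplacianAt σ w x L) {A : Set (E n)} (hA : MeasurableSet A)
    (hAfin : volume A ≠ ⊤) (hAκ : ∀ y ∈ A, inner ℝ y ν < κ) {r : ℝ} (hr : 0 < r)
    (hAr : Disjoint A (Metric.ball x r)) {B : ℝ}
    (hB : ∀ y ∈ A, ‖x - planeReflection ν κ y‖ ≤ B) :
    L ≤ fracConst n σ * volume.real A / B ^ ((n : ℝ) + 2 * σ) * w x := by
  refine (h.fracLaplacian_le hσ₀ hσ₁ hw hM hL hA hAfin hAκ hr hAr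
    (t := 2 * w x / B ^ ((n : ℝ) + 2 * σ)) fun y hy => ?_).trans (by ring_nf; rfl)
  have hpos : 0 < ‖x - planeReflection ν κ y‖ := (norm_nonneg _).trans_lt
    (norm_sub_lt_norm_sub_planeReflection h.norm_eq_one h.inner_lt (hAκ y hy))
  refine (h.folded_le hσ₀.le (hAκ y hy).le).trans
    (div_le_div_of_nonpos_left (by linarith [h.nonpos]) (by positivity) ?_)
  gcongr
  exact hB y hy

theorem folded_neg (h : IsAntisymmetricMinAt ν κ w x) (hσ : 0 < σ) (hwx : w x = 0) {z : E n}
    (hz : inner ℝ z ν < κ) (hwz : 0 < w z) :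
    fracIntegrand σ w x z + fracIntegrand σ w x (planeReflection ν κ z) < 0 := by
  have hxz : 0 < ‖x - z‖ := norm_sub_pos_iff.mpr fun heq => by
    rw [heq] at hwx
    exact hwz.ne' hwx
  have hlt : ‖x - z‖ ^ ((n : ℝ) + 2 * σ) < ‖x - planeReflection ν κ z‖ ^ ((n : ℝ) + 2 * σ) := by
    gcongr
    exact norm_sub_lt_norm_sub_planeReflection h.norm_eq_one h.inner_lt hz
  have := div_lt_div_of_pos_left hwz (by positivity) hlt
  rw [fracIntegrand, fracIntegrand, h.odd, hwx, zero_sub, zero_sub, neg_neg, neg_div]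
  linarith

theorem fracLaplacian_neg (h : IsAntisymmetricMinAt ν κ w x) (hσ₀ : 0 < σ) (hσ₁ : σ < 1)
    (hw : Continuous w) {M : ℝ} (hM : ∀ y, |w y| ≤ M) {L : ℝ} (hL : HasFracLaplacianAt σ w x L)
    (hwx : w x = 0) {z : E n} (hz : inner ℝ z ν < κ) (hwz : 0 < w z) : L < 0 := by
  let Φ : E n → ℝ := fun y => fracIntegrand σ w x y + fracIntegrand σ w x (planeReflection ν κ y)
  have hΦz : Φ z < 0 := h.folded_neg hσ₀ hwx hz hwz
  have hxz : 0 < ‖x - z‖ := norm_sub_pos_iff.mpr fun heq => by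
    rw [heq] at hwx
    exact hwz.ne' hwx
  have hxRz : 0 < ‖x - planeReflection ν κ z‖ :=
    hxz.trans (norm_sub_lt_norm_sub_planeReflection h.norm_eq_one h.inner_lt hz)
  have hΦ : ContinuousAt Φ z := by
    have hpow : ∀ y, 0 < ‖x - y‖ → ContinuousAt (fracIntegrand σ w x) y := fun y hy =>
      (by fun_prop : ContinuousAt (fun y => w x - w y) y).div
        ((by fun_prop : ContinuousAt (fun y => ‖x - y‖) y).rpow_const (Or.inl hy.ne'))
        (by positivity)
    exact (hpow z hxz).add
      ((hpow _ hxRz).comp (planeReflection ν κ).continuous.continuousAt)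
  have hnear : ∀ᶠ y in 𝓝 z, Φ y < Φ z / 2 ∧ inner ℝ y ν < κ :=
    (hΦ.eventually_lt continuousAt_const (by linarith)).and
      ((by fun_prop : ContinuousAt (fun y => inner ℝ y ν) z).eventually_lt continuousAt_const hz)
  obtain ⟨η, hη, hball⟩ := Metric.eventually_nhds_iff_ball.mp hnear
  have hr : 0 < min η (‖x - z‖ / 2) := by positivity
  have hdisj : Disjoint (Metric.ball z (min η (‖x - z‖ / 2))) (Metric.ball x (‖x - z‖ / 2)) :=
    Metric.ball_disjoint_ball (by
      rw [dist_comm, dist_eq_norm]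
      linarith [min_le_right η (‖x - z‖ / 2)])
  have hsub := Metric.ball_subset_ball (x := z) (min_le_left η (‖x - z‖ / 2))
  refine (h.fracLaplacian_le hσ₀ hσ₁ hw hM hL measurableSet_ball measure_ball_lt_top.ne
    (fun y hy => (hball y (hsub hy)).2) (half_pos hxz) hdisj
    fun y hy => (hball y (hsub hy)).1.le).trans_lt ?_
  have hvol := ENNReal.toReal_pos (Metric.measure_ball_pos volume z hr).ne' measure_ball_lt_top.ne
  exact mul_neg_of_pos_of_neg (fracConst_pos n hσ₀ hσ₁)
    (div_neg_of_neg_of_pos (mul_neg_of_neg_of_pos (by linarith) hvol) two_pos)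

end IsAntisymmetricMinAt

end AntisymmetricMinimum

/-! ### Navier problems as systems -/

section Chain

variable {n : ℕ} {Ω : Set (E n)} {f : E n → ℝ}

theorem negLaplacian_of_mem (hΩ : IsOpen Ω) (hu : UniqueDiffOn ℝ (closure Ω)) (f : E n → ℝ)
    {x : E n} (hx : x ∈ Ω) : negLaplacian Ω f x = -Laplacian.laplacian f x := by
  have hxc : x ∈ closure Ω := subset_closure hx
  have hnhds : closure Ω =ᶠ[𝓝 x] Set.univ :=
    Filter.eventuallyEq_univ.mpr (Filter.mem_of_superset (hΩ.mem_nhds hx) subset_closure)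
  rw [negLaplacian, if_pos hxc,
    InnerProductSpace.laplacianWithin_eq_iteratedFDerivWithin_stdOrthonormalBasis f hu hxc,
    InnerProductSpace.laplacian_eq_iteratedFDeriv_stdOrthonormalBasis]
  simp only [iteratedFDerivWithin_congr_set hnhds, iteratedFDerivWithin_univ]

theorem contDiffOn_negLaplacian (hu : UniqueDiffOn ℝ (closure Ω)) {k : ℕ}
    (hf : ContDiffOn ℝ ((k + 2 : ℕ) : WithTop ℕ∞) f (closure Ω)) :
    ContDiffOn ℝ (k : WithTop ℕ∞) (negLaplacian Ω f) (closure Ω) := by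
  have hD2 : ContDiffOn ℝ (k : WithTop ℕ∞) (iteratedFDerivWithin ℝ 2 f (closure Ω))
      (closure Ω) := fun x hx => (hf x hx).iteratedFDerivWithin_right hu (by norm_cast) hx
  have hsum : ContDiffOn ℝ (k : WithTop ℕ∞) (fun x => -∑ i,
      iteratedFDerivWithin ℝ 2 f (closure Ω) x
        ![stdOrthonormalBasis ℝ (E n) i, stdOrthonormalBasis ℝ (E n) i]) (closure Ω) :=
    (ContDiffOn.sum fun i _ => (ContinuousMultilinearMap.apply ℝ (fun _ : Fin 2 => E n) ℝ
      ![stdOrthonormalBasis ℝ (E n) i, stdOrthonormalBasis ℝ (E n) i]).contDiff.comp_contDiffOn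
        hD2).neg
  refine hsum.congr fun x hx => ?_
  rw [negLaplacian, if_pos hx,
    InnerProductSpace.laplacianWithin_eq_iteratedFDerivWithin_stdOrthonormalBasis f hu hx]

theorem negLaplacianPow_succ (i : ℕ) (f : E n → ℝ) :
    negLaplacianPow Ω (i + 1) f = negLaplacian Ω (negLaplacianPow Ω i f) :=
  Function.iterate_succ_apply' _ _ _

theorem contDiffOn_negLaplacianPow (hu : UniqueDiffOn ℝ (closure Ω)) {m : ℕ}
    (hf : ContDiffOn ℝ ((2 * m : ℕ) : WithTop ℕ∞) f (closure Ω)) {i : ℕ} (hi : i ≤ m) :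
    ContDiffOn ℝ ((2 * (m - i) : ℕ) : WithTop ℕ∞) (negLaplacianPow Ω i f) (closure Ω) := by
  induction i with
  | zero => exact hf
  | succ i ih =>
    rw [negLaplacianPow_succ]
    refine contDiffOn_negLaplacian hu ?_
    rw [show 2 * (m - (i + 1)) + 2 = 2 * (m - i) by lia]
    exact ih (by lia)

theorem continuous_of_continuousOn_closure {X : Type*} [TopologicalSpace X] {D : Set X}
    {f : X → ℝ} (hD : IsOpen D) (hf : ContinuousOn f (closure D)) (hf₀ : ∀ x ∉ D, f x = 0) :
    Continuous f := by
  have hcompl : ContinuousOn f Dᶜ := continuousOn_const.congr hf₀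
  refine continuousOn_univ.mp
    ((hf.union_of_isClosed hcompl isClosed_closure hD.isClosed_compl).mono fun x _ => ?_)
  exact (em (x ∈ D)).imp_left (subset_closure ·)

/-- The system satisfied by the functions `U i = (-Δ)^i u`, `i ≤ m`, when `(-Δ)^(m + σ) u = g` in
`Ω` with a positive source `g` and Navier exterior conditions. -/
structure IsNavierChain (Ω : Set (E n)) (m : ℕ) (σ : ℝ) (U : ℕ → E n → ℝ) (g : E n → ℝ) :
    Prop where
  order_mem : σ ∈ Set.Ioo 0 1
  continuous : ∀ i ≤ m, Continuous (U i)
  contDiffAt : ∀ i < m, ∀ x ∈ Ω, ContDiffAt ℝ 2 (U i) x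
  laplacian : ∀ i < m, ∀ x ∈ Ω, Laplacian.laplacian (U i) x = -U (i + 1) x
  eq_zero : ∀ i ≤ m, ∀ x ∉ Ω, U i x = 0
  frac : ∀ x ∈ Ω, HasFracLaplacianAt σ (U m) x (g x)
  source_pos : ∀ x ∈ Ω, 0 < g x

/-- `u` is a positive solution of `(-Δ)^(m + σ) u = g` in `Ω` with the Navier exterior conditions
`(-Δ)^i u = 0` outside `Ω` for `i ≤ m`. -/
structure IsPositiveNavierSolution (Ω : Set (E n)) (m : ℕ) (σ : ℝ) (u g : E n → ℝ) : Prop where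
  contDiffOn : ContDiffOn ℝ ((2 * m : ℕ) : WithTop ℕ∞) u (closure Ω)
  pos : ∀ x ∈ Ω, 0 < u x
  frac : ∀ x ∈ Ω, HasFracLaplacianAt σ (negLaplacianPow Ω m u) x (g x)
  navier : ∀ i ≤ m, ∀ x ∉ Ω, negLaplacianPow Ω i u x = 0

theorem IsPositiveNavierSolution.isNavierChain {m : ℕ} {σ : ℝ} {u g : E n → ℝ}
    (h : IsPositiveNavierSolution Ω m σ u g) (hσ : σ ∈ Set.Ioo 0 1) (hΩo : IsOpen Ω)
    (hΩc : Convex ℝ Ω) (hg : ∀ x ∈ Ω, 0 < g x) :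
    IsNavierChain Ω m σ (fun i => negLaplacianPow Ω i u) g := by
  rcases Ω.eq_empty_or_nonempty with rfl | hne
  · refine ⟨hσ, fun i hi => ?_, by simp, by simp, h.navier, h.frac, hg⟩
    rw [funext fun x => h.navier i hi x (Set.notMem_empty x)]
    exact continuous_const
  have hud : UniqueDiffOn ℝ (closure Ω) :=
    uniqueDiffOn_convex hΩc.closure (hne.mono (interior_maximal subset_closure hΩo))
  have hreg := fun i (hi : i ≤ m) => contDiffOn_negLaplacianPow hud h.contDiffOn hi
  refine ⟨hσ, fun i hi => ?_, fun i hi x hx => ?_, fun i _ x hx => ?_, h.navier, h.frac, hg⟩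
  · exact continuous_of_continuousOn_closure hΩo (hreg i hi).continuousOn (h.navier i hi)
  · refine ((hreg i hi.le).contDiffAt
      (Filter.mem_of_superset (hΩo.mem_nhds hx) subset_closure)).of_le ?_
    exact_mod_cast (by lia : 2 ≤ 2 * (m - i))
  · rw [negLaplacianPow_succ, negLaplacian_of_mem hΩo hud _ hx, neg_neg]

end Chain

section Positivity

theorem exists_forall_le_of_nonpos {X : Type*} [PseudoMetricSpace X] [ProperSpace X] {D S : Set X}
    (hDb : Bornology.IsBounded D) (hDS : closure D ⊆ S) {f : X → ℝ} (hf : Continuous f)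
    (hf₀ : ∀ x ∈ S, x ∉ D → 0 ≤ f x) {x : X} (hx : x ∈ D) (hfx : f x ≤ 0) :
    ∃ y ∈ D, f y ≤ f x ∧ ∀ z ∈ S, f y ≤ f z := by
  obtain ⟨y, hy, hmin⟩ := hDb.isCompact_closure.exists_isMinOn ⟨x, subset_closure hx⟩
    hf.continuousOn
  have hyx : f y ≤ f x := hmin (subset_closure hx)
  have hyS : ∀ z ∈ S, f y ≤ f z := fun z hz => by
    by_cases hzD : z ∈ D
    · exact hmin (subset_closure hzD)
    · linarith [hf₀ z hz hzD]
  by_cases hyD : y ∈ D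
  · exact ⟨y, hyD, hyx, hyS⟩
  · have hfyx : f y = f x := le_antisymm hyx (hfx.trans (hf₀ y (hDS hy) hyD))
    exact ⟨x, hx, le_rfl, fun z hz => hfyx ▸ hyS z hz⟩

namespace IsNavierChain

variable {n m : ℕ} {Ω : Set (E n)} {σ : ℝ} {U : ℕ → E n → ℝ} {g : E n → ℝ}

theorem pos (h : IsNavierChain Ω m σ U g) (hΩb : Bornology.IsBounded Ω) {i : ℕ} (hi : i ≤ m) :
    ∀ x ∈ Ω, 0 < U i x := by
  have hmin : ∀ j ≤ m, ∀ x ∈ Ω, U j x ≤ 0 → ∃ y ∈ Ω, ∀ z, U j y ≤ U j z := fun j hj x hx hle => by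
    obtain ⟨y, hy, -, hymin⟩ := exists_forall_le_of_nonpos hΩb (Set.subset_univ _)
      (h.continuous j hj) (fun z _ hz => (h.eq_zero j hj z hz).ge) hx hle
    exact ⟨y, hy, fun z => hymin z trivial⟩
  induction hi using Nat.decreasingInduction with
  | self =>
    intro x hx
    by_contra! hle
    obtain ⟨y, hy, hymin⟩ := hmin m le_rfl x hx hle
    exact ((h.frac y hy).nonpos_of_forall_le h.order_mem.1 h.order_mem.2 hymin).not_gt
      (h.source_pos y hy)
  | of_succ k hk ih =>
    intro x hx
    by_contra! hle
    obtain ⟨y, hy, hymin⟩ := hmin k hk.le x hx hle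
    have hlap := laplacian_nonneg_of_isLocalMin (h.contDiffAt k hk y hy)
      (Filter.Eventually.of_forall hymin)
    rw [h.laplacian k hk y hy] at hlap
    linarith [ih y hy]

theorem nonneg (h : IsNavierChain Ω m σ U g) (hΩb : Bornology.IsBounded Ω) {i : ℕ} (hi : i ≤ m)
    (x : E n) : 0 ≤ U i x := by
  by_cases hx : x ∈ Ω
  · exact (h.pos hΩb hi x hx).le
  · exact (h.eq_zero i hi x hx).ge

theorem exists_abs_le (h : IsNavierChain Ω m σ U g) (hΩb : Bornology.IsBounded Ω) {i : ℕ}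
    (hi : i ≤ m) : ∃ M, ∀ x, |U i x| ≤ M :=
  (h.continuous i hi).bounded_above_of_compact_support <|
    HasCompactSupport.intro hΩb.isCompact_closure fun x hx =>
      h.eq_zero i hi x fun hxΩ => hx (subset_closure hxΩ)

end IsNavierChain

end Positivity

/-! ### Reflection of a Navier system -/

section Caps

variable {n : ℕ} {Ω : Set (E n)} {x₀ ν : E n} {δ κ : ℝ}

/-- The part of `Ω` below the hyperplane `{⟪·, ν⟫ = κ}`. -/
def cap (Ω : Set (E n)) (ν : E n) (κ : ℝ) : Set (E n) :=
  Ω ∩ {x | inner ℝ x ν < κ}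

theorem isOpen_cap (hΩ : IsOpen Ω) : IsOpen (cap Ω ν κ) :=
  hΩ.inter (isOpen_lt (by fun_prop) continuous_const)

theorem convex_cap (hΩ : Convex ℝ Ω) : Convex ℝ (cap Ω ν κ) :=
  hΩ.inter (convex_halfSpace_lt ((innerₗ (E n)).flip ν).isLinear κ)

theorem closure_cap_subset : closure (cap Ω ν κ) ⊆ {x | inner ℝ x ν ≤ κ} :=
  closure_minimal (fun x hx => le_of_lt (show inner ℝ x ν < κ from hx.2))
     (isClosed_le (by fun_prop) continuous_const)

/-- `Ω` is a bounded convex domain, `x₀` is a point of `∂Ω` that is lowest in the direction `ν`,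
and the closed caps of height up to `δ` above `x₀` reflect into `Ω`, so that the moving plane can
advance to the height `δ`. -/
structure ReflectsCaps (Ω : Set (E n)) (x₀ ν : E n) (δ : ℝ) : Prop where
  isOpen : IsOpen Ω
  convex : Convex ℝ Ω
  isBounded : Bornology.IsBounded Ω
  norm_eq_one : ‖ν‖ = 1
  mem_closure : x₀ ∈ closure Ω
  notMem : x₀ ∉ Ω
  inner_le : ∀ x ∈ closure Ω, inner ℝ x₀ ν ≤ inner ℝ x ν
  reflection_mem : ∀ κ ≤ inner ℝ x₀ ν + δ, ∀ x ∈ closure Ω, inner ℝ x ν < κ →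
    planeReflection ν κ x ∈ Ω

theorem ReflectsCaps.reflection_mem_of_mem_cap (hR : ReflectsCaps Ω x₀ ν δ)
    (hκ : κ ≤ inner ℝ x₀ ν + δ) {x : E n} (hx : x ∈ cap Ω ν κ) : planeReflection ν κ x ∈ Ω :=
  hR.reflection_mem κ hκ x (subset_closure hx.1) hx.2

theorem ReflectsCaps.exists_forall_norm_sub_lt (hR : ReflectsCaps Ω x₀ ν δ) :
    ∃ ρ > 0, ∀ x ∈ Ω, ‖x - x₀‖ < ρ := by
  obtain ⟨ρ, hρ, hsub⟩ := hR.isBounded.subset_ball_lt 0 x₀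
  exact ⟨ρ, hρ, fun x hx => mem_ball_iff_norm.mp (hsub hx)⟩

/-- The function `x ↦ f(x^κ) - f(x)`, with `x^κ` the reflection of `x` in `{⟪·, ν⟫ = κ}`. -/
def reflectionDiff (ν : E n) (κ : ℝ) (f : E n → ℝ) (x : E n) : ℝ :=
  f (planeReflection ν κ x) - f x

theorem reflectionDiff_planeReflection (ν : E n) (κ : ℝ) (f : E n → ℝ) (x : E n) :
    reflectionDiff ν κ f (planeReflection ν κ x) = -reflectionDiff ν κ f x := by
  rw [reflectionDiff, planeReflection_involutive, reflectionDiff, neg_sub]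

theorem continuous_reflectionDiff {f : E n → ℝ} (hf : Continuous f) :
    Continuous (reflectionDiff ν κ f) :=
  (hf.comp (planeReflection ν κ).continuous).sub hf

theorem abs_reflectionDiff_le {f : E n → ℝ} {M : ℝ} (hM : ∀ x, |f x| ≤ M) (x : E n) :
    |reflectionDiff ν κ f x| ≤ M + M :=
  (abs_sub _ _).trans (add_le_add (hM _) (hM _))

theorem reflectionDiff_nonneg_of_notMem_cap (hν : ‖ν‖ = 1) {f : E n → ℝ} (hf : ∀ x, 0 ≤ f x)
    (hf₀ : ∀ x ∉ Ω, f x = 0) {x : E n} (hx : inner ℝ x ν ≤ κ) (hxc : x ∉ cap Ω ν κ) :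
    0 ≤ reflectionDiff ν κ f x := by
  by_cases hxΩ : x ∈ Ω
  · have hxκ : inner ℝ x ν = κ := hx.antisymm (not_lt.mp fun h => hxc ⟨hxΩ, h⟩)
    simp [reflectionDiff, planeReflection_eq_add_smul hν, hxκ]
  · rw [reflectionDiff, hf₀ x hxΩ, sub_zero]
    exact hf _

theorem abs_inner_sub_inner_lt_of_mem_ball (hν : ‖ν‖ = 1) {x y : E n} {r : ℝ}
    (hy : y ∈ Metric.ball x r) : |inner ℝ y ν - inner ℝ x ν| < r := by
  rw [← inner_sub_left]
  refine (abs_real_inner_le_norm _ _).trans_lt ?_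
  rwa [hν, mul_one, ← mem_ball_iff_norm]

/-- The folded kernel is bounded below on a unit ball placed at distance `2` below `Ω`: this ball
yields the constant. -/
theorem ReflectsCaps.exists_fracLaplacian_le_mul (hR : ReflectsCaps Ω x₀ ν δ) {σ : ℝ}
    (hσ : σ ∈ Set.Ioo 0 1) :
    ∃ θ > 0, ∀ κ ≤ inner ℝ x₀ ν + δ, ∀ w : E n → ℝ, Continuous w → ∀ M, (∀ y, |w y| ≤ M) →
      ∀ x ∈ cap Ω ν κ, IsAntisymmetricMinAt ν κ w x → ∀ L, HasFracLaplacianAt σ w x L →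
      L ≤ θ * w x := by
  obtain ⟨B, hB⟩ := Metric.isBounded_iff.mp
    (hR.isBounded.union (Metric.isBounded_ball (x := x₀ - (2 : ℝ) • ν) (r := 1)))
  have hlow : ∀ y ∈ Metric.ball (x₀ - (2 : ℝ) • ν) 1, inner ℝ y ν < inner ℝ x₀ ν - 1 :=
    fun y hy => by
      have := (abs_lt.mp (abs_inner_sub_inner_lt_of_mem_ball hR.norm_eq_one hy)).2
      rw [inner_sub_left, real_inner_smul_left, real_inner_self_eq_norm_sq, hR.norm_eq_one] at this
      linarith
  refine ⟨fracConst n σ * MeasureTheory.volume.real (Metric.ball (x₀ - (2 : ℝ) • ν) 1)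
    / max B 1 ^ ((n : ℝ) + 2 * σ), ?_, fun κ hκ w hw M hM x hx hmin L hL => ?_⟩
  · have := fracConst_pos n hσ.1 hσ.2
    have := ENNReal.toReal_pos
      (Metric.measure_ball_pos MeasureTheory.volume (x₀ - (2 : ℝ) • ν) one_pos).ne'
      MeasureTheory.measure_ball_lt_top.ne
    exact div_pos (by positivity) (by positivity)
  have hx₀x := hR.inner_le x (subset_closure hx.1)
  refine hmin.fracLaplacian_le_of_norm_le hσ.1 hσ.2 hw hM hL measurableSet_ball
    MeasureTheory.measure_ball_lt_top.ne (fun y hy => by linarith [hlow y hy, hmin.inner_lt])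
    one_pos (Set.disjoint_left.mpr fun y hy hyx => ?_) fun y hy => ?_
  · have := abs_lt.mp (abs_inner_sub_inner_lt_of_mem_ball hR.norm_eq_one hyx)
    linarith [hlow y hy]
  · rw [← dist_eq_norm, ← (planeReflection ν κ).dist_eq, planeReflection_involutive]
    exact (hB (.inl (hR.reflection_mem_of_mem_cap hκ hx)) (.inr hy)).trans (le_max_left _ _)

end Caps

section ReflectedChain

namespace IsNavierChain

variable {n m : ℕ} {Ω : Set (E n)} {σ δ κ : ℝ} {x₀ ν : E n} {U : ℕ → E n → ℝ} {g : E n → ℝ}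

theorem reflectionDiff_nonneg_of_notMem_cap (h : IsNavierChain Ω m σ U g)
    (hR : ReflectsCaps Ω x₀ ν δ) {i : ℕ} (hi : i ≤ m) {x : E n} (hx : inner ℝ x ν ≤ κ)
    (hxc : x ∉ cap Ω ν κ) : 0 ≤ reflectionDiff ν κ (U i) x :=
  LaneEmden.reflectionDiff_nonneg_of_notMem_cap hR.norm_eq_one (h.nonneg hR.isBounded hi)
    (h.eq_zero i hi) hx hxc

theorem hasFracLaplacianAt_reflectionDiff (h : IsNavierChain Ω m σ U g)
    (hR : ReflectsCaps Ω x₀ ν δ) (hκ : κ ≤ inner ℝ x₀ ν + δ) {x : E n} (hx : x ∈ cap Ω ν κ) :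
    HasFracLaplacianAt σ (reflectionDiff ν κ (U m)) x (reflectionDiff ν κ g x) := by
  obtain ⟨M, hM⟩ := h.exists_abs_le hR.isBounded le_rfl
  have hUm := h.continuous m le_rfl
  exact HasFracLaplacianAt.sub h.order_mem.1 (hUm.comp (planeReflection ν κ).continuous) hUm
    (fun y => hM _) hM
    (.comp_isometryEquiv h.order_mem.1 hUm hM _
      (h.frac _ (hR.reflection_mem_of_mem_cap hκ hx))) (h.frac x hx.1)

theorem contDiffAt_reflectionDiff (h : IsNavierChain Ω m σ U g) (hR : ReflectsCaps Ω x₀ ν δ)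
    (hκ : κ ≤ inner ℝ x₀ ν + δ) {i : ℕ} (hi : i < m) {x : E n} (hx : x ∈ cap Ω ν κ) :
    ContDiffAt ℝ 2 (reflectionDiff ν κ (U i)) x :=
  ((h.contDiffAt i hi _ (hR.reflection_mem_of_mem_cap hκ hx)).comp x
    (contDiff_planeReflection ν κ).contDiffAt).sub (h.contDiffAt i hi x hx.1)

theorem laplacian_reflectionDiff (h : IsNavierChain Ω m σ U g) (hR : ReflectsCaps Ω x₀ ν δ)
    (hκ : κ ≤ inner ℝ x₀ ν + δ) {i : ℕ} (hi : i < m) {x : E n} (hx : x ∈ cap Ω ν κ) :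
    Laplacian.laplacian (reflectionDiff ν κ (U i)) x = -reflectionDiff ν κ (U (i + 1)) x := by
  have hRx := hR.reflection_mem_of_mem_cap hκ hx
  have hcomp : ContDiffAt ℝ 2 (U i ∘ planeReflection ν κ) x :=
    (h.contDiffAt i hi _ hRx).comp x (contDiff_planeReflection ν κ).contDiffAt
  calc Laplacian.laplacian (U i ∘ planeReflection ν κ - U i) x
      = -U (i + 1) (planeReflection ν κ x) - -U (i + 1) x := by
        rw [hcomp.laplacian_sub (h.contDiffAt i hi x hx.1), laplacian_comp_planeReflection,
          h.laplacian i hi _ hRx, h.laplacian i hi x hx.1]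
    _ = -reflectionDiff ν κ (U (i + 1)) x := by rw [reflectionDiff]; ring

theorem isAntisymmetricMinAt_reflectionDiff (h : IsNavierChain Ω m σ U g)
    (hR : ReflectsCaps Ω x₀ ν δ) {i : ℕ} (hi : i ≤ m) {x : E n} (hx : x ∈ cap Ω ν κ)
    (hwx : reflectionDiff ν κ (U i) x ≤ 0)
    (hmin : ∀ y ∈ cap Ω ν κ, reflectionDiff ν κ (U i) x ≤ reflectionDiff ν κ (U i) y) :
    IsAntisymmetricMinAt ν κ (reflectionDiff ν κ (U i)) x where
  norm_eq_one := hR.norm_eq_one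
  odd := reflectionDiff_planeReflection ν κ _
  inner_lt := hx.2
  nonpos := hwx
  le y hy := by
    by_cases hyc : y ∈ cap Ω ν κ
    · exact hmin y hyc
    · exact hwx.trans (h.reflectionDiff_nonneg_of_notMem_cap hR hi hy hyc)

theorem exists_neg_div_le_reflectionDiff (h : IsNavierChain Ω m σ U g)
    (hR : ReflectsCaps Ω x₀ ν δ) :
    ∃ θ > 0, ∀ κ ≤ inner ℝ x₀ ν + δ, ∀ a, 0 ≤ a →
      (∀ x ∈ cap Ω ν κ, -a ≤ reflectionDiff ν κ g x) →
      ∀ x ∈ cap Ω ν κ, -(a / θ) ≤ reflectionDiff ν κ (U m) x := by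
  obtain ⟨θ, hθ, hle⟩ := hR.exists_fracLaplacian_le_mul h.order_mem
  obtain ⟨M, hM⟩ := h.exists_abs_le hR.isBounded le_rfl
  refine ⟨θ, hθ, fun κ hκ a ha hga x hx => ?_⟩
  have hw := continuous_reflectionDiff (ν := ν) (κ := κ) (h.continuous m le_rfl)
  by_contra! hlt
  have hwx : reflectionDiff ν κ (U m) x ≤ 0 := hlt.le.trans (neg_nonpos.mpr (by positivity))
  obtain ⟨y, hy, hyx, hymin⟩ := exists_forall_le_of_nonpos
    (hR.isBounded.subset Set.inter_subset_left) closure_cap_subset hw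
    (fun z hz hzc => h.reflectionDiff_nonneg_of_notMem_cap hR le_rfl hz hzc) hx hwx
  have hL := hle κ hκ _ hw _ (abs_reflectionDiff_le hM) y hy
    (h.isAntisymmetricMinAt_reflectionDiff hR le_rfl hy (hyx.trans hwx)
      fun z hz => hymin z (closure_cap_subset (subset_closure hz))) _
    (h.hasFracLaplacianAt_reflectionDiff hR hκ hy)
  have hlt' : θ * reflectionDiff ν κ (U m) y < -a := by
    rw [← lt_div_iff₀' hθ, neg_div]
    exact hyx.trans_lt hlt
  linarith [hga y hy]

theorem neg_mul_sq_le_reflectionDiff (h : IsNavierChain Ω m σ U g) (hR : ReflectsCaps Ω x₀ ν δ)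
    (hκ : κ ≤ inner ℝ x₀ ν + δ) {i : ℕ} (hi : i < m) {a ε : ℝ} (ha : 0 ≤ a) (hε : 0 < ε)
    (hw : ∀ x ∈ cap Ω ν κ, -a ≤ reflectionDiff ν κ (U (i + 1)) x)
    (hnarrow : ∀ x ∈ cap Ω ν κ, reflectionDiff ν κ (U i) x < 0 →
      ∃ z ∉ cap Ω ν κ, ‖x - z‖ < ε) :
    ∀ x ∈ cap Ω ν κ, -(a * ε ^ 2) ≤ reflectionDiff ν κ (U i) x := by
  refine neg_mul_sq_le_of_narrow (isOpen_cap hR.isOpen) (convex_cap hR.convex)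
    (hR.isBounded.subset Set.inter_subset_left) ha hε
    (continuous_reflectionDiff (h.continuous i hi.le)).continuousOn
    (fun x hx => h.contDiffAt_reflectionDiff hR hκ hi hx) (fun x hx => ?_) (fun x hx => ?_) hnarrow
  · rw [(isOpen_cap hR.isOpen).frontier_eq] at hx
    exact h.reflectionDiff_nonneg_of_notMem_cap hR hi.le (closure_cap_subset hx.1) hx.2
  · rw [h.laplacian_reflectionDiff hR hκ hi hx, neg_le]
    exact hw x hx

theorem neg_mul_pow_le_reflectionDiff (h : IsNavierChain Ω m σ U g) (hR : ReflectsCaps Ω x₀ ν δ)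
    (hκ : κ ≤ inner ℝ x₀ ν + δ) {a ρ : ℝ} (ha : 0 ≤ a) (hρ : 0 < ρ)
    (hΩρ : ∀ x ∈ Ω, ‖x - x₀‖ < ρ) (hw : ∀ x ∈ cap Ω ν κ, -a ≤ reflectionDiff ν κ (U m) x)
    {i : ℕ} (hi : i ≤ m) :
    ∀ x ∈ cap Ω ν κ, -(a * (ρ ^ 2) ^ (m - i)) ≤ reflectionDiff ν κ (U i) x := by
  induction hi using Nat.decreasingInduction with
  | self => simpa using hw
  | of_succ k hk ih =>
    rw [show m - k = m - (k + 1) + 1 by lia, pow_succ, ← mul_assoc]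
    exact h.neg_mul_sq_le_reflectionDiff hR hκ hk (by positivity) hρ ih
      fun x hx _ => ⟨x₀, fun hx₀ => hR.notMem hx₀.1, hΩρ x hx.1⟩

theorem reflectionDiff_nonneg (h : IsNavierChain Ω m σ U g) (hR : ReflectsCaps Ω x₀ ν δ)
    (hκ : κ ≤ inner ℝ x₀ ν + δ) (hg : ∀ x ∈ cap Ω ν κ, 0 ≤ reflectionDiff ν κ g x) {i : ℕ}
    (hi : i ≤ m) : ∀ x ∈ cap Ω ν κ, 0 ≤ reflectionDiff ν κ (U i) x := by
  obtain ⟨ρ, hρ, hΩρ⟩ := hR.exists_forall_norm_sub_lt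
  obtain ⟨θ, -, htop⟩ := h.exists_neg_div_le_reflectionDiff hR
  have hw : ∀ x ∈ cap Ω ν κ, -0 ≤ reflectionDiff ν κ (U m) x := by
    simpa using htop κ hκ 0 le_rfl (by simpa using hg)
  simpa using h.neg_mul_pow_le_reflectionDiff hR hκ le_rfl hρ hΩρ hw hi

theorem exists_neg_mul_sq_le_reflectionDiff (h : IsNavierChain Ω m σ U g)
    (hR : ReflectsCaps Ω x₀ ν δ) (hm : 0 < m) :
    ∃ C, 0 ≤ C ∧ ∀ κ ≤ inner ℝ x₀ ν + δ, ∀ a, 0 ≤ a → ∀ ε > 0,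
      (∀ x ∈ cap Ω ν κ, -a ≤ reflectionDiff ν κ g x) →
      (∀ x ∈ cap Ω ν κ, reflectionDiff ν κ (U 0) x < 0 → ∃ z ∉ cap Ω ν κ, ‖x - z‖ < ε) →
      ∀ x ∈ cap Ω ν κ, -(C * a * ε ^ 2) ≤ reflectionDiff ν κ (U 0) x := by
  obtain ⟨ρ, hρ, hΩρ⟩ := hR.exists_forall_norm_sub_lt
  obtain ⟨θ, hθ, htop⟩ := h.exists_neg_div_le_reflectionDiff hR
  refine ⟨(ρ ^ 2) ^ (m - 1) / θ, by positivity, fun κ hκ a ha ε hε hga hnarrow => ?_⟩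
  rw [show (ρ ^ 2) ^ (m - 1) / θ * a = a / θ * (ρ ^ 2) ^ (m - 1) by ring]
  exact h.neg_mul_sq_le_reflectionDiff hR hκ hm (by positivity) hε
    (h.neg_mul_pow_le_reflectionDiff hR hκ (by positivity) hρ hΩρ (htop κ hκ a ha hga) hm) hnarrow

theorem reflectionDiff_top_pos (h : IsNavierChain Ω m σ U g) (hR : ReflectsCaps Ω x₀ ν δ)
    (hκ : κ ≤ inner ℝ x₀ ν + δ) (hg : ∀ x ∈ cap Ω ν κ, 0 ≤ reflectionDiff ν κ g x) :
    ∀ x ∈ cap Ω ν κ, 0 < reflectionDiff ν κ (U m) x := by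
  intro x hx
  have hnonneg := h.reflectionDiff_nonneg hR hκ hg le_rfl
  refine (hnonneg x hx).lt_of_ne' fun hwx => ?_
  obtain ⟨M, hM⟩ := h.exists_abs_le hR.isBounded le_rfl
  have hx₀κ : inner ℝ x₀ ν < κ := (hR.inner_le x (subset_closure hx.1)).trans_lt hx.2
  have hwx₀ : 0 < reflectionDiff ν κ (U m) x₀ := by
    rw [reflectionDiff, h.eq_zero m le_rfl x₀ hR.notMem, sub_zero]
    exact h.pos hR.isBounded le_rfl _ (hR.reflection_mem κ hκ x₀ hR.mem_closure hx₀κ)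
  have hneg := (h.isAntisymmetricMinAt_reflectionDiff hR le_rfl hx hwx.le
    fun y hy => hwx.le.trans (hnonneg y hy)).fracLaplacian_neg h.order_mem.1 h.order_mem.2
      (continuous_reflectionDiff (h.continuous m le_rfl)) (abs_reflectionDiff_le hM)
      (h.hasFracLaplacianAt_reflectionDiff hR hκ hx) hwx hx₀κ hwx₀
  exact hneg.not_ge (hg x hx)

theorem reflectionDiff_pos (h : IsNavierChain Ω m σ U g) (hR : ReflectsCaps Ω x₀ ν δ)
    (hκ : κ ≤ inner ℝ x₀ ν + δ) (hg : ∀ x ∈ cap Ω ν κ, 0 ≤ reflectionDiff ν κ g x) {i : ℕ}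
    (hi : i ≤ m) : ∀ x ∈ cap Ω ν κ, 0 < reflectionDiff ν κ (U i) x := by
  induction hi using Nat.decreasingInduction with
  | self => exact h.reflectionDiff_top_pos hR hκ hg
  | of_succ k hk ih =>
    intro x hx
    have hnonneg := h.reflectionDiff_nonneg hR hκ hg hk.le
    refine (hnonneg x hx).lt_of_ne' fun hwx => ?_
    have hmin : IsLocalMin (reflectionDiff ν κ (U k)) x := by
      filter_upwards [(isOpen_cap hR.isOpen).mem_nhds hx] with y hy
      exact hwx.le.trans (hnonneg y hy)
    have hlap := laplacian_nonneg_of_isLocalMin (h.contDiffAt_reflectionDiff hR hκ hk hx) hmin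
    rw [h.laplacian_reflectionDiff hR hκ hk hx] at hlap
    linarith [ih x hx]

end IsNavierChain

end ReflectedChain

/-! ### Moving planes -/

section Nonlinearity

variable {n : ℕ} {Ω : Set (E n)} {ν : E n} {κ : ℝ} {f : ℝ → ℝ} {v : E n → ℝ}

/-- The nonlinearities for which the moving plane method works: positive on `(0, ∞)`, and
nondecreasing and locally Lipschitz on `[0, ∞)`. -/
structure IsAdmissibleNonlinearity (f : ℝ → ℝ) : Prop where
  pos : ∀ t > 0, 0 < f t
  monotoneOn : MonotoneOn f (Set.Ici 0)
  locallyLipschitzOn : LocallyLipschitzOn (Set.Ici 0) f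

namespace IsAdmissibleNonlinearity

theorem exists_neg_mul_le_sub (hf : IsAdmissibleNonlinearity f) (M : ℝ) :
    ∃ C, 0 ≤ C ∧ ∀ a, 0 ≤ a → ∀ s ∈ Set.Icc 0 M, ∀ t, 0 ≤ t → -a ≤ t - s →
      -(C * a) ≤ f t - f s := by
  obtain ⟨K, hK⟩ := (hf.locallyLipschitzOn.mono
    Set.Icc_subset_Ici_self).exists_lipschitzOnWith_of_compact (isCompact_Icc (a := 0) (b := M))
  refine ⟨K, K.coe_nonneg, fun a ha s hs t ht hts => ?_⟩
  rcases le_total s t with hst | hst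
  · have hmono := hf.monotoneOn hs.1 ht hst
    have : 0 ≤ K * a := by positivity
    linarith
  · have hlip := hK.dist_le_mul s hs t ⟨ht, hst.trans hs.2⟩
    rw [Real.dist_eq, Real.dist_eq, abs_of_nonneg (sub_nonneg.mpr hst)] at hlip
    have hsa : K * (s - t) ≤ K * a := by
      gcongr
      linarith
    linarith [le_abs_self (f s - f t)]

theorem reflectionDiff_comp_nonneg (hf : IsAdmissibleNonlinearity f) (hv : ∀ x, 0 ≤ v x)
    (h : ∀ x ∈ cap Ω ν κ, 0 ≤ reflectionDiff ν κ v x) :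
    ∀ x ∈ cap Ω ν κ, 0 ≤ reflectionDiff ν κ (f ∘ v) x := fun x hx =>
  sub_nonneg.mpr (hf.monotoneOn (hv _) (hv _) (sub_nonneg.mp (h x hx)))

end IsAdmissibleNonlinearity

end Nonlinearity

section MovingPlanes

variable {n : ℕ} {Ω : Set (E n)} {x₀ ν : E n} {δ κ κ' ε : ℝ}

theorem continuous_uncurry_reflectionDiff (ν : E n) {f : E n → ℝ} (hf : Continuous f) :
    Continuous fun z : ℝ × E n => reflectionDiff ν z.1 f z.2 := by
  simp only [reflectionDiff, planeReflection_apply]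
  fun_prop

theorem isClosed_setOf_reflectionDiff_nonneg {f : E n → ℝ} (hf : Continuous f) :
    IsClosed {κ | ∀ x ∈ cap Ω ν κ, 0 ≤ reflectionDiff ν κ f x} := by
  have hset : {κ | ∀ x ∈ cap Ω ν κ, 0 ≤ reflectionDiff ν κ f x}
      = ⋂ x ∈ Ω, ({κ | κ ≤ inner ℝ x ν} ∪ {κ | 0 ≤ reflectionDiff ν κ f x}) := by
    ext κ
    simp only [cap, Set.mem_inter_iff, Set.mem_ofPred_eq, Set.mem_iInter, Set.mem_union, and_imp,
      ← not_lt, ← imp_iff_not_or]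
  rw [hset]
  exact isClosed_biInter fun x _ => (isClosed_le continuous_id continuous_const).union
    (isClosed_le continuous_const ((continuous_uncurry_reflectionDiff ν hf).comp
      (f := fun κ : ℝ => (κ, x)) (by fun_prop)))

theorem exists_notMem_cap_norm_sub_lt (hν : ‖ν‖ = 1) (hκ : κ ≤ κ') (hκ' : κ' < κ + ε / 2)
    {x z : E n} (hz : z ∉ cap Ω ν κ) (hxz : ‖x - z‖ < ε / 2) :
    ∃ z' ∉ cap Ω ν κ', ‖x - z'‖ < ε := by
  by_cases hzΩ : z ∈ Ω
  · have hzκ : κ ≤ inner ℝ z ν := not_lt.mp fun h => hz ⟨hzΩ, h⟩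
    refine ⟨z + (κ' - κ) • ν, fun hmem => ?_, ?_⟩
    · have hlt : inner ℝ (z + (κ' - κ) • ν) ν < κ' := hmem.2
      rw [inner_add_left, real_inner_smul_left, real_inner_self_eq_norm_sq, hν] at hlt
      linarith
    · have hle := norm_sub_le (x - z) ((κ' - κ) • ν)
      rw [norm_smul, hν, Real.norm_of_nonneg (sub_nonneg.mpr hκ)] at hle
      rw [← sub_sub]
      linarith
  · exact ⟨z, fun h => hzΩ h.1, by linarith [norm_nonneg (x - z)]⟩

theorem eventually_exists_notMem_cap_norm_sub_lt (hν : ‖ν‖ = 1) (hΩ : Bornology.IsBounded Ω)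
    {f : E n → ℝ} (hf : Continuous f) (hpos : ∀ x ∈ cap Ω ν κ, 0 < reflectionDiff ν κ f x)
    (hε : 0 < ε) :
    ∀ᶠ κ' in 𝓝[>] κ, ∀ x, reflectionDiff ν κ' f x < 0 → ∃ z ∉ cap Ω ν κ', ‖x - z‖ < ε := by
  let K : Set (E n) := {x | ∀ z ∉ cap Ω ν κ, ε / 2 ≤ ‖x - z‖}
  have hKcap : K ⊆ cap Ω ν κ := fun x hx => by
    by_contra hxc
    have := hx x hxc
    rw [sub_self, norm_zero] at this
    linarith
  have hK : IsCompact K := by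
    refine Metric.isCompact_of_isClosed_isBounded ?_
      (hΩ.subset (hKcap.trans Set.inter_subset_left))
    simp only [K, Set.ofPred_forall]
    exact isClosed_biInter fun z _ => isClosed_le continuous_const (by fun_prop)
  have hposK : ∀ᶠ κ' in 𝓝 κ, ∀ x ∈ K, 0 < reflectionDiff ν κ' f x :=
    hK.eventually_forall_of_forall_eventually fun x hx =>
      (continuous_uncurry_reflectionDiff ν hf).continuousAt.eventually_const_lt
        (hpos x (hKcap hx))
  filter_upwards [nhdsWithin_le_nhds hposK, self_mem_nhdsWithin,
    nhdsWithin_le_nhds (Iio_mem_nhds (by linarith : κ < κ + ε / 2))]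
    with κ' hposκ' (hκκ' : κ < κ') (hκε : κ' < κ + ε / 2) x hx
  have hxK : x ∉ K := fun h => (hposκ' x h).not_gt hx
  simp only [K, Set.mem_ofPred_eq, not_forall, not_le] at hxK
  obtain ⟨z, hz, hxz⟩ := hxK
  exact exists_notMem_cap_norm_sub_lt hν hκκ'.le hκε hz hxz

theorem nonneg_of_forall_neg_half_le {X : Type*} {D : Set X} {f : X → ℝ} {N : ℝ} (hN : 0 ≤ N)
    (hfN : ∀ x ∈ D, -N ≤ f x)
    (hstep : ∀ a, 0 ≤ a → (∀ x ∈ D, -a ≤ f x) → ∀ x ∈ D, -(a / 2) ≤ f x) :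
    ∀ x ∈ D, 0 ≤ f x := by
  have hpow : ∀ k : ℕ, ∀ x ∈ D, -(N * (1 / 2) ^ k) ≤ f x := fun k => by
    induction k with
    | zero => simpa using hfN
    | succ k ih =>
      rw [show N * (1 / 2) ^ (k + 1) = N * (1 / 2) ^ k / 2 by ring]
      exact hstep _ (by positivity) ih
  have hlim : Filter.Tendsto (fun k : ℕ => -(N * (1 / 2 : ℝ) ^ k)) Filter.atTop (𝓝 0) := by
    simpa using ((tendsto_pow_atTop_nhds_zero_of_lt_one (r := (1 / 2 : ℝ)) (by norm_num)
      (by norm_num)).const_mul N).neg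
  exact fun x hx => le_of_tendsto' hlim fun k => hpow k x hx

variable {m : ℕ} {σ : ℝ} {U V : ℕ → E n → ℝ} {f g : ℝ → ℝ}

theorem IsNavierChain.exists_neg_half_le_reflectionDiff {v : E n → ℝ}
    (hU : IsNavierChain Ω m σ U (f ∘ v)) (hR : ReflectsCaps Ω x₀ ν δ) (hm : 0 < m)
    (hf : IsAdmissibleNonlinearity f) (hv : ∀ x, 0 ≤ v x) {M : ℝ} (hM : ∀ x, |v x| ≤ M) :
    ∃ ε > 0, ∀ κ ≤ inner ℝ x₀ ν + δ, ∀ a, 0 ≤ a →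
      (∀ x ∈ cap Ω ν κ, -a ≤ reflectionDiff ν κ v x) →
      (∀ x ∈ cap Ω ν κ, reflectionDiff ν κ (U 0) x < 0 → ∃ z ∉ cap Ω ν κ, ‖x - z‖ < ε) →
      ∀ x ∈ cap Ω ν κ, -(a / 2) ≤ reflectionDiff ν κ (U 0) x := by
  obtain ⟨Λ, hΛ, hlip⟩ := hf.exists_neg_mul_le_sub M
  obtain ⟨C, hC, hnarrow⟩ := hU.exists_neg_mul_sq_le_reflectionDiff hR hm
  obtain ⟨ε, hε, hεC⟩ : ∃ ε : ℝ, 0 < ε ∧ C * Λ * ε ^ 2 ≤ 1 / 2 := by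
    refine ⟨√(1 / (2 * (C * Λ + 1))), by positivity, ?_⟩
    rw [Real.sq_sqrt (by positivity), mul_one_div, div_le_div_iff₀ (by positivity) two_pos]
    linarith
  refine ⟨ε, hε, fun κ hκ a ha hva hnear x hx => ?_⟩
  have hfva : ∀ x ∈ cap Ω ν κ, -(Λ * a) ≤ reflectionDiff ν κ (f ∘ v) x := fun x hx =>
    hlip a ha (v x) ⟨hv x, (le_abs_self _).trans (hM x)⟩ _ (hv _) (hva x hx)
  calc -(a / 2) ≤ -(C * Λ * ε ^ 2 * a) := by linarith [mul_le_mul_of_nonneg_right hεC ha]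
    _ = -(C * (Λ * a) * ε ^ 2) := by ring
    _ ≤ reflectionDiff ν κ (U 0) x :=
      hnarrow κ hκ (Λ * a) (by positivity) ε hε hfva hnear x hx

theorem IsNavierChain.eventually_neg_half_le_reflectionDiff {v : E n → ℝ}
    (hU : IsNavierChain Ω m σ U (f ∘ v)) (hR : ReflectsCaps Ω x₀ ν δ) (hm : 0 < m)
    (hf : IsAdmissibleNonlinearity f) (hv : ∀ x, 0 ≤ v x) {M : ℝ} (hM : ∀ x, |v x| ≤ M)
    (hκ : κ ≤ inner ℝ x₀ ν + δ) (h : ∀ x ∈ cap Ω ν κ, 0 ≤ reflectionDiff ν κ v x) :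
    ∀ᶠ κ' in 𝓝[>] κ, κ' ≤ inner ℝ x₀ ν + δ → ∀ a, 0 ≤ a →
      (∀ x ∈ cap Ω ν κ', -a ≤ reflectionDiff ν κ' v x) →
      ∀ x ∈ cap Ω ν κ', -(a / 2) ≤ reflectionDiff ν κ' (U 0) x := by
  obtain ⟨ε, hε, hhalf⟩ := hU.exists_neg_half_le_reflectionDiff hR hm hf hv hM
  have hpos := hU.reflectionDiff_pos hR hκ (hf.reflectionDiff_comp_nonneg hv h) hm.le
  filter_upwards [eventually_exists_notMem_cap_norm_sub_lt hR.norm_eq_one hR.isBounded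
    (hU.continuous 0 hm.le) hpos hε] with κ' hnear hκ' a ha hva
  exact hhalf κ' hκ' a ha hva fun x _ => hnear x

theorem eventually_reflectionDiff_nonneg (hR : ReflectsCaps Ω x₀ ν δ) (hm : 0 < m)
    (hf : IsAdmissibleNonlinearity f) (hg : IsAdmissibleNonlinearity g)
    (hU : IsNavierChain Ω m σ U (f ∘ V 0)) (hV : IsNavierChain Ω m σ V (g ∘ U 0))
    (hκ : κ ≤ inner ℝ x₀ ν + δ) (hUκ : ∀ x ∈ cap Ω ν κ, 0 ≤ reflectionDiff ν κ (U 0) x)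
    (hVκ : ∀ x ∈ cap Ω ν κ, 0 ≤ reflectionDiff ν κ (V 0) x) :
    ∀ᶠ κ' in 𝓝[>] κ, κ' ≤ inner ℝ x₀ ν + δ →
      (∀ x ∈ cap Ω ν κ', 0 ≤ reflectionDiff ν κ' (U 0) x) ∧
        ∀ x ∈ cap Ω ν κ', 0 ≤ reflectionDiff ν κ' (V 0) x := by
  obtain ⟨M, hM⟩ := hU.exists_abs_le hR.isBounded hm.le
  obtain ⟨N, hN⟩ := hV.exists_abs_le hR.isBounded hm.le
  filter_upwards [
    hU.eventually_neg_half_le_reflectionDiff hR hm hf (hV.nonneg hR.isBounded hm.le) hN hκ hVκ,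
    hV.eventually_neg_half_le_reflectionDiff hR hm hg (hU.nonneg hR.isBounded hm.le) hM hκ hUκ]
    with κ' hUhalf hVhalf hκ'
  rw [← forall₂_and]
  simp only [← le_min_iff]
  have hM₀ : 0 ≤ M := (abs_nonneg _).trans (hM x₀)
  have hN₀ : 0 ≤ N := (abs_nonneg _).trans (hN x₀)
  refine nonneg_of_forall_neg_half_le (N := (M + M) + (N + N)) (by positivity)
    (fun x _ => le_min ?_ ?_) fun a ha h => ?_
  · linarith [neg_le_of_abs_le (abs_reflectionDiff_le (ν := ν) (κ := κ') hM x)]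
  · linarith [neg_le_of_abs_le (abs_reflectionDiff_le (ν := ν) (κ := κ') hN x)]
  · simp only [le_min_iff, forall₂_and] at h ⊢
    exact ⟨hUhalf hκ' a ha h.2, hVhalf hκ' a ha h.1⟩

theorem reflectionDiff_nonneg_of_le (hR : ReflectsCaps Ω x₀ ν δ) (hm : 0 < m)
    (hf : IsAdmissibleNonlinearity f) (hg : IsAdmissibleNonlinearity g)
    (hU : IsNavierChain Ω m σ U (f ∘ V 0)) (hV : IsNavierChain Ω m σ V (g ∘ U 0))
    (hκ : κ ≤ inner ℝ x₀ ν + δ) :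
    (∀ x ∈ cap Ω ν κ, 0 ≤ reflectionDiff ν κ (U 0) x) ∧
      ∀ x ∈ cap Ω ν κ, 0 ≤ reflectionDiff ν κ (V 0) x := by
  let S : Set ℝ := {κ | ∀ x ∈ cap Ω ν κ, 0 ≤ reflectionDiff ν κ (U 0) x} ∩
    {κ | ∀ x ∈ cap Ω ν κ, 0 ≤ reflectionDiff ν κ (V 0) x}
  have hS : IsClosed S := (isClosed_setOf_reflectionDiff_nonneg (hU.continuous 0 hm.le)).inter
    (isClosed_setOf_reflectionDiff_nonneg (hV.continuous 0 hm.le))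
  have hcap : ∀ κ ≤ inner ℝ x₀ ν, ∀ x, x ∉ cap Ω ν κ := fun κ hκ x hx =>
    (hκ.trans (hR.inner_le x (subset_closure hx.1))).not_gt hx.2
  have hlow : ∀ κ ≤ inner ℝ x₀ ν, κ ∈ S := fun κ hκ =>
    ⟨fun x hx => absurd hx (hcap κ hκ x), fun x hx => absurd hx (hcap κ hκ x)⟩
  have hIcc : Set.Icc (inner ℝ x₀ ν) (inner ℝ x₀ ν + δ) ⊆ S := by
    refine (hS.inter isClosed_Icc).Icc_subset_of_forall_exists_gt (hlow _ le_rfl) ?_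
    rintro κ ⟨hκS, -, hκδ⟩ y (hy : κ < y)
    refine Filter.Eventually.exists (f := 𝓝[>] κ) ?_
    filter_upwards [eventually_reflectionDiff_nonneg hR hm hf hg hU hV hκδ.le hκS.1 hκS.2,
      Ioc_mem_nhdsGT hy, Ioc_mem_nhdsGT hκδ] with κ' hκ' hκy hκδ'
    exact ⟨hκ' hκδ'.2, hκy⟩
  rcases le_total κ (inner ℝ x₀ ν) with hle | hle
  · exact hlow κ hle
  · exact hIcc ⟨hle, hκ⟩

theorem IsNavierChain.strictlyIncreasingAlong {g : E n → ℝ} (h : IsNavierChain Ω m σ U g)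
    (hR : ReflectsCaps Ω x₀ ν δ)
    (hg : ∀ κ ≤ inner ℝ x₀ ν + δ, ∀ x ∈ cap Ω ν κ, 0 ≤ reflectionDiff ν κ g x) {i : ℕ}
    (hi : i ≤ m) : StrictlyIncreasingAlong (U i) ν (boundaryLayer Ω x₀ ν δ) := by
  rintro x ⟨hx, -, -⟩ t ht ⟨-, -, hxt⟩
  have hxκ : inner ℝ x ν < inner ℝ x ν + t / 2 := by linarith
  have hκ : inner ℝ x ν + t / 2 ≤ inner ℝ x₀ ν + δ := by
    rw [inner_sub_left, inner_add_left, real_inner_smul_left, real_inner_self_eq_norm_sq,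
      hR.norm_eq_one] at hxt
    linarith
  have hrefl : planeReflection ν (inner ℝ x ν + t / 2) x = x + t • ν := by
    rw [planeReflection_eq_add_smul hR.norm_eq_one]
    module
  rw [← hrefl]
  by_cases hxΩ : x ∈ Ω
  · exact sub_pos.mp (h.reflectionDiff_pos hR hκ (hg _ hκ) hi x ⟨hxΩ, hxκ⟩)
  · rw [h.eq_zero i hi x hxΩ]
    exact h.pos hR.isBounded hi _ (hR.reflection_mem _ hκ x hx hxκ)

theorem ReflectsCaps.strictlyIncreasingAlong (hR : ReflectsCaps Ω x₀ ν δ)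
    (hσ : σ ∈ Set.Ioo 0 1) (hm : 0 < m) (hf : IsAdmissibleNonlinearity f)
    (hg : IsAdmissibleNonlinearity g) {u v : E n → ℝ}
    (hu : IsPositiveNavierSolution Ω m σ u (f ∘ v))
    (hv : IsPositiveNavierSolution Ω m σ v (g ∘ u)) {i : ℕ} (hi : i ≤ m) :
    StrictlyIncreasingAlong (negLaplacianPow Ω i u) ν (boundaryLayer Ω x₀ ν δ) ∧
      StrictlyIncreasingAlong (negLaplacianPow Ω i v) ν (boundaryLayer Ω x₀ ν δ) := by
  have hU := hu.isNavierChain hσ hR.isOpen hR.convex fun x hx => hf.pos _ (hv.pos x hx)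
  have hV := hv.isNavierChain hσ hR.isOpen hR.convex fun x hx => hg.pos _ (hu.pos x hx)
  have hnonneg := fun κ (hκ : κ ≤ inner ℝ x₀ ν + δ) =>
    reflectionDiff_nonneg_of_le (U := fun i => negLaplacianPow Ω i u)
      (V := fun i => negLaplacianPow Ω i v) hR hm hf hg hU hV hκ
  exact ⟨hU.strictlyIncreasingAlong hR (fun κ hκ => hf.reflectionDiff_comp_nonneg
      (hV.nonneg hR.isBounded hm.le) (hnonneg κ hκ).2) hi,
    hV.strictlyIncreasingAlong hR (fun κ hκ => hg.reflectionDiff_comp_nonneg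
      (hU.nonneg hR.isBounded hm.le) (hnonneg κ hκ).1) hi⟩

end MovingPlanes

/-! ### Geometry of small caps -/

section Geometry

variable {n : ℕ} {Ω U : Set (E n)} {x₀ ν : E n} {ρ : E n → ℝ}

namespace IsLocalDefiningFunction

theorem nonneg_of_mem_closure (h : IsLocalDefiningFunction Ω x₀ U ρ) {x : E n} (hxU : x ∈ U)
    (hx : x ∈ closure Ω) : 0 ≤ ρ x := by
  by_cases hxΩ : x ∈ Ω
  · exact ((h.mem_domain_iff x hxU).mp hxΩ).le
  · exact ((h.mem_frontier_iff x hxU).mp ⟨hx, fun hxi => hxΩ (interior_subset hxi)⟩).ge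

theorem contDiffAt (h : IsLocalDefiningFunction Ω x₀ U ρ) {x : E n} (hx : x ∈ U) :
    ContDiffAt ℝ ∞ ρ x :=
  h.smooth.contDiffAt (h.isOpen.mem_nhds hx)

theorem inner_gradient_nonneg (h : IsLocalDefiningFunction Ω x₀ U ρ) (hΩ : Convex ℝ Ω)
    (hx₀ : x₀ ∈ frontier Ω) {y : E n} (hy : y ∈ closure Ω) :
    0 ≤ inner ℝ (gradient ρ x₀) (y - x₀) := by
  have hmin : IsLocalMinOn ρ (closure Ω) x₀ := by
    filter_upwards [self_mem_nhdsWithin, nhdsWithin_le_nhds (h.isOpen.mem_nhds h.mem)]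
      with x hx hxU
    rw [(h.mem_frontier_iff x₀ h.mem).mp hx₀]
    exact h.nonneg_of_mem_closure hxU hx
  rw [gradient, InnerProductSpace.toDual_symm_apply]
  exact hmin.hasFDerivWithinAt_nonneg
    ((h.contDiffAt h.mem).differentiableAt (by simp)).hasFDerivAt.hasFDerivWithinAt
    (sub_mem_posTangentConeAt_of_segment_subset (hΩ.closure.segment_subset hx₀.1 hy))

theorem exists_forall_add_smul_mem (h : IsLocalDefiningFunction Ω x₀ U ρ)
    (hν : 0 < inner ℝ (gradient ρ x₀) ν) :
    ∃ r > 0, ∀ x ∈ closure Ω, x ∈ Metric.ball x₀ r → ∀ t : ℝ, 0 < t →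
      x + t • ν ∈ Metric.ball x₀ r → x + t • ν ∈ Ω := by
  rw [gradient, InnerProductSpace.toDual_symm_apply] at hν
  have hderiv : ∀ᶠ z in 𝓝 x₀, 0 < fderiv ℝ ρ z ν := by
    have hcont : ContinuousAt (fun z => fderiv ℝ ρ z ν) x₀ :=
      ((h.contDiffAt h.mem).fderiv_right (m := 0) (by simp)).continuousAt.clm_apply
        continuousAt_const
    exact hcont.eventually_const_lt hν
  obtain ⟨r, hr, hball⟩ := Metric.eventually_nhds_iff_ball.mp
    ((h.isOpen.eventually_mem h.mem).and hderiv)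
  refine ⟨r, hr, fun x hx hxr t ht hxtr => ?_⟩
  obtain ⟨z, hz, heq⟩ := domain_mvt (f := ρ) (f' := fderiv ℝ ρ) (fun z hz =>
    ((h.contDiffAt (hball z hz).1).differentiableAt (by simp)).hasFDerivAt.hasFDerivWithinAt)
    (convex_ball x₀ r) hxr hxtr
  have hzpos := (hball z ((convex_ball x₀ r).segment_subset hxr hxtr hz)).2
  rw [add_sub_cancel_left, map_smul, smul_eq_mul] at heq
  have hxnonneg := h.nonneg_of_mem_closure (hball x hxr).1 hx
  refine (h.mem_domain_iff _ (hball _ hxtr).1).mpr ?_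
  linarith [mul_pos ht hzpos]

end IsLocalDefiningFunction

theorem IsUnitInwardNormal.norm_eq_one (hν : IsUnitInwardNormal Ω x₀ ν) : ‖ν‖ = 1 := by
  obtain ⟨U, ρ, h, rfl⟩ := hν
  exact norm_smul_inv_norm h.gradient_ne_zero

theorem IsUnitInwardNormal.inner_le (hν : IsUnitInwardNormal Ω x₀ ν) (hΩ : Convex ℝ Ω)
    (hx₀ : x₀ ∈ frontier Ω) {x : E n} (hx : x ∈ closure Ω) : inner ℝ x₀ ν ≤ inner ℝ x ν := by
  obtain ⟨U, ρ, h, rfl⟩ := hν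
  have hnonneg := h.inner_gradient_nonneg hΩ hx₀ hx
  rw [← sub_nonneg, ← inner_sub_left, real_inner_smul_right, real_inner_comm]
  positivity

theorem IsUnitInwardNormal.exists_forall_add_smul_mem (hν : IsUnitInwardNormal Ω x₀ ν) :
    ∃ r > 0, ∀ x ∈ closure Ω, x ∈ Metric.ball x₀ r → ∀ t : ℝ, 0 < t →
      x + t • ν ∈ Metric.ball x₀ r → x + t • ν ∈ Ω := by
  obtain ⟨U, ρ, h, rfl⟩ := hν
  refine h.exists_forall_add_smul_mem ?_
  have : 0 < ‖gradient ρ x₀‖ := norm_pos_iff.mpr h.gradient_ne_zero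
  rw [real_inner_smul_right, real_inner_self_eq_norm_sq]
  positivity

theorem inner_lt_of_strictConvex {F : Type*} [NormedAddCommGroup F] [InnerProductSpace ℝ F]
    {K : Set F} (hK : StrictConvex ℝ K) {x y ν : F} (hν : ν ≠ 0)
    (hmin : ∀ z ∈ K, inner ℝ x ν ≤ inner ℝ z ν) (hx : x ∈ K) (hy : y ∈ K) (hyx : y ≠ x) :
    inner ℝ x ν < inner ℝ y ν := by
  refine (hmin y hy).lt_of_ne fun heq => hν ?_
  let z : F := (1 / 2 : ℝ) • x + (1 / 2 : ℝ) • y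
  have hz : z ∈ interior K := hK hx hy hyx.symm one_half_pos one_half_pos (add_halves 1)
  have hzν : innerSL ℝ ν z = inner ℝ x ν := by
    rw [innerSL_apply_apply, real_inner_comm, inner_add_left, real_inner_smul_left,
      real_inner_smul_left, ← heq]
    ring
  have hlocal : IsLocalMin (innerSL ℝ ν) z := by
    filter_upwards [mem_interior_iff_mem_nhds.mp hz] with w hw
    rw [hzν, innerSL_apply_apply, real_inner_comm w ν]
    exact hmin w hw
  exact inner_self_eq_zero.mp
    (DFunLike.congr_fun (hlocal.hasFDerivAt_eq_zero (innerSL ℝ ν).hasFDerivAt) ν)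

theorem exists_forall_le_add_imp_dist_lt {X : Type*} [PseudoMetricSpace X] {K : Set X}
    (hK : IsCompact K) {x₀ : X} {f : X → ℝ} (hf : ContinuousOn f K)
    (hmin : ∀ y ∈ K, y ≠ x₀ → f x₀ < f y) {r : ℝ} (hr : 0 < r) :
    ∃ η > 0, ∀ x ∈ K, f x ≤ f x₀ + η → dist x x₀ < r := by
  obtain ⟨c, hc, hfar⟩ := (hK.diff Metric.isOpen_ball).exists_forall_le'
    (hf.mono Set.sdiff_subset) (a := f x₀) fun y (hy : y ∈ K \ Metric.ball x₀ r) =>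
      hmin y hy.1 fun h => hy.2 (h ▸ Metric.mem_ball_self hr)
  refine ⟨(c - f x₀) / 2, by linarith, fun x hx hxη => ?_⟩
  by_contra hxr
  linarith [hfar x ⟨hx, hxr⟩]

theorem exists_reflectsCaps (hΩ : IsSmoothStrictlyConvexDomain Ω) (hx₀ : x₀ ∈ frontier Ω)
    (hν : IsUnitInwardNormal Ω x₀ ν) : ∃ δ > 0, ReflectsCaps Ω x₀ ν δ := by
  have hν₁ := hν.norm_eq_one
  have hle : ∀ x ∈ closure Ω, inner ℝ x₀ ν ≤ inner ℝ x ν :=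
    fun x hx => hν.inner_le hΩ.convex hx₀ hx
  have hlt : ∀ x ∈ closure Ω, x ≠ x₀ → inner ℝ x₀ ν < inner ℝ x ν := fun x hx =>
    inner_lt_of_strictConvex hΩ.strictConvex_closure (norm_ne_zero_iff.mp (hν₁ ▸ one_ne_zero))
      hle hx₀.1 hx
  obtain ⟨r, hr, hin⟩ := hν.exists_forall_add_smul_mem
  obtain ⟨η, hη, hlow⟩ := exists_forall_le_add_imp_dist_lt hΩ.bounded.isCompact_closure
    (f := fun x => inner ℝ x ν) (by fun_prop) hlt (half_pos hr)
  refine ⟨min η (r / 4), by positivity, hΩ.isOpen, hΩ.convex, hΩ.bounded, hν₁, hx₀.1,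
    (hΩ.isOpen.frontier_eq ▸ hx₀).2, hle, fun κ hκ x hx hxκ => ?_⟩
  have hκη : κ ≤ inner ℝ x₀ ν + η := hκ.trans (by gcongr; exact min_le_left _ _)
  have hκr : κ ≤ inner ℝ x₀ ν + r / 4 := hκ.trans (by gcongr; exact min_le_right _ _)
  have hxr : dist x x₀ < r / 2 := hlow x hx (hxκ.le.trans hκη)
  have hxle := hle x hx
  rw [planeReflection_eq_add_smul hν₁]
  have hT : 0 < 2 * (κ - inner ℝ x ν) := by linarith
  refine hin x hx (Metric.mem_ball.mpr (hxr.trans (half_lt_self hr))) _ hT ?_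
  rw [Metric.mem_ball, add_comm]
  calc dist ((2 * (κ - inner ℝ x ν)) • ν + x) x₀
      ≤ dist ((2 * (κ - inner ℝ x ν)) • ν + x) x + dist x x₀ := dist_triangle _ _ _
    _ = 2 * (κ - inner ℝ x ν) + dist x x₀ := by
      rw [dist_add_self_left, norm_smul, hν₁, mul_one, Real.norm_of_nonneg hT.le]
    _ < r := by linarith

end Geometry

theorem isAdmissibleNonlinearity_rpow {p : ℝ} (hp : 1 ≤ p) :
    IsAdmissibleNonlinearity fun t => t ^ p where
  pos t ht := Real.rpow_pos_of_pos ht p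
  monotoneOn := Real.monotoneOn_rpow_Ici_of_exponent_nonneg (zero_le_one.trans hp)
  locallyLipschitzOn := (Real.contDiff_rpow_const_of_le (n := 1)
    (by simpa using hp)).locallyLipschitz.locallyLipschitzOn

theorem IsPositiveNavierSolution.of_isClassical {n : ℕ} {Ω : Set (E n)} {u g : E n → ℝ}
    (hn : Odd n) (hu : IsClassical Ω u) (hpos : ∀ x ∈ Ω, 0 < u x)
    (heq : ∀ x ∈ Ω, HasHalfDimLaplacianAt Ω u x (g x))
    (hnavier : ∀ i ≤ (n - 1) / 2, ∀ x ∉ Ω, negLaplacianPow Ω i u x = 0) :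
    IsPositiveNavierSolution Ω ((n - 1) / 2) (1 / 2) u g where
  contDiffOn := by
    rw [Nat.two_mul_div_two_of_even (Nat.Odd.sub_odd hn odd_one)]
    exact hu.2
  pos := hpos
  frac := heq
  navier := hnavier

end LaneEmden

end

theorem theorem1p1_general {n : ℕ} {Ω : Set (LaneEmden.E n)}
    (hΩ : LaneEmden.IsSmoothStrictlyConvexDomain Ω) {x₀ : LaneEmden.E n} (hx₀ : x₀ ∈ frontier Ω)
    {ν : LaneEmden.E n} (hν : LaneEmden.IsUnitInwardNormal Ω x₀ ν) :
    ∃ δ₀ : ℝ, 0 < δ₀ ∧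
      ∀ m > 0, ∀ σ ∈ Set.Ioo (0 : ℝ) 1, ∀ f g : ℝ → ℝ,
      LaneEmden.IsAdmissibleNonlinearity f → LaneEmden.IsAdmissibleNonlinearity g →
      ∀ u v : LaneEmden.E n → ℝ, LaneEmden.IsPositiveNavierSolution Ω m σ u (f ∘ v) →
      LaneEmden.IsPositiveNavierSolution Ω m σ v (g ∘ u) →
        ∀ i ≤ m,
          LaneEmden.StrictlyIncreasingAlong (LaneEmden.negLaplacianPow Ω i u) ν
            (LaneEmden.boundaryLayer Ω x₀ ν δ₀) ∧
          LaneEmden.StrictlyIncreasingAlong (LaneEmden.negLaplacianPow Ω i v) ν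
            (LaneEmden.boundaryLayer Ω x₀ ν δ₀) := by
  obtain ⟨δ₀, hδ₀, hR⟩ := LaneEmden.exists_reflectsCaps hΩ hx₀ hν
  exact ⟨δ₀, hδ₀, fun m hm σ hσ f g hf hg u v hu hv i hi =>
    hR.strictlyIncreasingAlong hσ hm hf hg hu hv hi⟩

theorem theorem1p1 (n : ℕ) (hn : 3 ≤ n) (hodd : Odd n)
    (Ω : Set (LaneEmden.E n)) (hΩ : LaneEmden.IsSmoothStrictlyConvexDomain Ω)
    (x₀ : LaneEmden.E n) (hx₀ : x₀ ∈ frontier Ω)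
    (ν : LaneEmden.E n) (hν : LaneEmden.IsUnitInwardNormal Ω x₀ ν) :
    ∃ δ₀ : ℝ, 0 < δ₀ ∧
      ∀ (p q : ℝ), 1 ≤ p → 1 ≤ q → 1 < p * q →
      ∀ (u v : LaneEmden.E n → ℝ), LaneEmden.IsPositiveClassicalSolution Ω p q u v →
        ∀ i ≤ (n - 1) / 2,
          LaneEmden.StrictlyIncreasingAlong (LaneEmden.negLaplacianPow Ω i u) ν
            (LaneEmden.boundaryLayer Ω x₀ ν δ₀) ∧
          LaneEmden.StrictlyIncreasingAlong (LaneEmden.negLaplacianPow Ω i v) ν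
            (LaneEmden.boundaryLayer Ω x₀ ν δ₀) := by
  obtain ⟨δ₀, hδ₀, hmono⟩ := theorem1p1_general hΩ hx₀ hν
  exact ⟨δ₀, hδ₀, fun p q hp hq _ u v h => hmono _ (by omega) (1 / 2) (by norm_num) _ _
    (LaneEmden.isAdmissibleNonlinearity_rpow hp) (LaneEmden.isAdmissibleNonlinearity_rpow hq) u v
    (.of_isClassical hodd h.classical_u h.pos_u h.eq_u h.navier_u)
    (.of_isClassical hodd h.classical_v h.pos_v h.eq_v h.navier_v)⟩
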